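/- Let $\mathbb D$ be the open unit disc of $\mathbb C$ and $dA=\frac1\pi\,dx\,dy$. For $a,b>-1$ let $$d\mu_{a,b}(z)=\frac{1}{\mathscr B(a+1,b+1)}\,|z|^{2b}(1-|z|^2)^{a}\,dA(z)\quad\text{on }\mathbb D,\qquad \mathscr B(s,t)=\frac{\Gamma(s)\Gamma(t)}{\Gamma(s+t)}.$$ Let $\alpha,a,b\in(-1,+\infty)$, let $m\in\mathbb N=\{0,1,2,\dots\}$, and consider the integral operators $$Tf(z)=\frac1{z^m}\int_{\mathbb D}\frac{f(w)(1-|w|^2)^{\alpha-a}\,w^m}{|w|^{2b}(1-z\overline w)^{2+\alpha}}\,d\mu_{a,b}(w),\qquad Sf(z)=\frac1{|z|^m}\int_{\mathbb D}\frac{f(w)(1-|w|^2)^{\alpha-a}\,|w|^{m-2b}}{|1-z\overline w|^{2+\alpha}}\,d\mu_{a,b}(w),$$ where $(1-z\overline w)^{2+\alpha}$ is the principal power. Such an operator is called bounded on $L^p(\mathbb D,d\mu_{a,b})$ if for every $f\in L^p(\mathbb D,d\mu_{a,b})$ the defining integral converges absolutely for almost every $z\in\mathbb D$, the resulting function belongs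 to $L^p(\mathbb D,d\mu_{a,b})$, and its norm is at most $C\|f\|_{L^p(\mathbb D,d\mu_{a,b})}$ with a constant $C$ independent of $f$. Then for every real $p$ with $1\le p<+\infty$ the following assertions are equivalent: 1. $T$ is bounded on $L^p(\mathbb D,d\mu_{a,b})$; 2. $S$ is bounded on $L^p(\mathbb D,d\mu_{a,b})$; 3. $p(\alpha+1)>a+1$, and $$\begin{cases} m-2<2b\le m & \text{if } p=1,\\ mp-2<2b<mp-2+2p & \text{if } p>1.\end{cases}$$ -/

import Mathlib

open MeasureTheory
open scoped ENNReal NNReal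

namespace MeroBergman

/-- The open unit disc of the complex plane. -/
def unitDisc : Set ℂ := Metric.ball 0 1

/-- The normalized area measure `dA = π⁻¹ dx dy` on the unit disc, as a measure on `ℂ`
that is carried by the disc. -/
noncomputable def areaMeasure : Measure ℂ :=
  ENNReal.ofReal (1 / Real.pi) • (volume : Measure ℂ).restrict unitDisc

/-- The measure `dμ_{a,b}(z) = B(a+1,b+1)⁻¹ |z|^{2b} (1-|z|²)^a dA(z)` on the unit disc,
where `B(s,t) = Γ(s)Γ(t)/Γ(s+t)` is the beta function. -/
noncomputable def diskMeasure (a b : ℝ) : Measure ℂ :=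
  areaMeasure.withDensity fun z =>
    ENNReal.ofReal
      (1 / ProbabilityTheory.beta (a + 1) (b + 1) * ‖z‖ ^ (2 * b) * (1 - ‖z‖ ^ 2) ^ a)

/-- The kernel of `T` with respect to `μ_{a,b}`:
`z^{-m} · (1-|w|²)^{α-a} w^m / (|w|^{2b} (1 - z w̄)^{2+α})`.
The complex power is the principal one; `1 - z w̄` has positive real part on the disc. -/
noncomputable def kernelT (α a b : ℝ) (m : ℕ) (z w : ℂ) : ℂ :=
  1 / z ^ m *
    ((((1 - ‖w‖ ^ 2) ^ (α - a) : ℝ) : ℂ) * w ^ m /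
      (((‖w‖ ^ (2 * b) : ℝ) : ℂ) * (1 - z * starRingEnd ℂ w) ^ ((2 + α : ℝ) : ℂ)))

/-- The kernel of `S` with respect to `μ_{a,b}`:
`|z|^{-m} · (1-|w|²)^{α-a} |w|^{m-2b} / |1 - z w̄|^{2+α}`. -/
noncomputable def kernelS (α a b : ℝ) (m : ℕ) (z w : ℂ) : ℂ :=
  ((1 / ‖z‖ ^ m *
    ((1 - ‖w‖ ^ 2) ^ (α - a) * ‖w‖ ^ ((m : ℝ) - 2 * b) /
      ‖1 - z * starRingEnd ℂ w‖ ^ (2 + α)) : ℝ) : ℂ)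

/-- The integral operator `f ↦ (z ↦ ∫ f(w) K(z,w) dμ(w))`. -/
noncomputable def integralOp (μ : Measure ℂ) (K : ℂ → ℂ → ℂ) (f : ℂ → ℂ) (z : ℂ) : ℂ :=
  ∫ w, f w * K z w ∂μ

/-- The integral operator with kernel `K` is a bounded operator on `L^p(μ)`: for every
`f ∈ L^p(μ)` the defining integral converges absolutely at almost every point, the resulting
function lies in `L^p(μ)`, and its norm is at most a constant times the norm of `f`. -/
def IsBoundedOnLp (μ : Measure ℂ) (p : ℝ≥0∞) (K : ℂ → ℂ → ℂ) : Prop :=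
  ∃ C : ℝ≥0, ∀ f : ℂ → ℂ, MemLp f p μ →
    (∀ᵐ z ∂μ, Integrable (fun w => f w * K z w) μ) ∧
    MemLp (integralOp μ K f) p μ ∧
    eLpNorm (integralOp μ K f) p μ ≤ C * eLpNorm f p μ

end MeroBergman

namespace MeroBergman

/-! Both kernels have modulus k(z,w) = |z|^{-m} (1-|w|²)^{α-a} |w|^{m-2b} |1-z w̄|^{-(2+α)}
(`absKernel`). `S` is the positive operator with kernel k, so it dominates `T` and 2 → 1 is
immediate.

3 → 2 rests on the Forelli–Rudin estimate with a power weight at the origin (`forelli_rudin`). For p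
= 1 it bounds ∫ k(z,w) dμ(z) uniformly in w, and Tonelli concludes. For p > 1, `schur_test` applies
with weight |w|^x (1-|w|²)^y; condition 3 is what makes the ranges required of x and y nonempty.

1 → 3 uses that 1/(1-z w̄)^{2+α} is close to 1 for z near 0. On test functions h(w)(w̄/|w|)^m with h
≥ 0, no cancellation occurs there, and |Tf(z)| ≥ ½ |z|^{-m} ∫ h g dμ with g = `radialKernel`
(`exists_test_bound_of_isBoundedOnLp`). Hence |z|^{-mp} is integrable near 0, which is the lower
bound on 2b; for p > 1, duality puts g in L^q for the conjugate exponent q, which gives the two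
other inequalities.

For p = 1 duality would only give α ≥ a. Instead, testing on normalized indicators of shrinking
balls bounds ∫ k(z,w) dμ(z) for every w ≠ 0 in the disc. If α ≤ a, letting w → 1 would make ∫
|1-z|^{-(2+a)} dμ finite, but it diverges logarithmically; letting w → 0 gives 2b ≤ m. -/

/-! ### One-variable power integrals and the size of |1 - x e^{iθ}|. -/

theorem lintegral_Ioo_rpow_le {s t : ℝ} (hs : -1 < s) (ht : 0 < t) :
    ∫⁻ x in Set.Ioo 0 t, ENNReal.ofReal (x ^ s) ≤ ENNReal.ofReal (t ^ (s + 1) / (s + 1)) := by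
  have hi : IntegrableOn (fun x : ℝ => x ^ s) (Set.Ioo 0 t) :=
    (intervalIntegral.integrableOn_Ioo_rpow_iff ht).2 hs
  rw [← ofReal_integral_eq_lintegral_ofReal hi]
  · rw [← integral_Ioc_eq_integral_Ioo, ← intervalIntegral.integral_of_le ht.le,
      integral_rpow (Or.inl hs), Real.zero_rpow (by linarith), sub_zero]
  · exact (ae_restrict_mem measurableSet_Ioo).mono fun x hx => Real.rpow_nonneg hx.1.le _

theorem lintegral_Ioi_rpow_le {c δ : ℝ} (hc : c < -1) (hδ : 0 < δ) :
    ∫⁻ x in Set.Ioi δ, ENNReal.ofReal (x ^ c) ≤ ENNReal.ofReal (δ ^ (c + 1) / (-c - 1)) := by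
  rw [← ofReal_integral_eq_lintegral_ofReal (integrableOn_Ioi_rpow_of_lt hc hδ),
    integral_Ioi_rpow_of_lt hc hδ]
  · apply le_of_eq
    congr 1
    rw [neg_div, ← div_neg]
    ring_nf
  · exact (ae_restrict_mem measurableSet_Ioi).mono fun x hx => Real.rpow_nonneg (hδ.le.trans hx.le) _

theorem neg_one_lt_of_lintegral_Ioo_rpow_lt_top {s t : ℝ} (ht : 0 < t)
    (h : ∫⁻ x in Set.Ioo 0 t, ENNReal.ofReal (x ^ s) < ∞) : -1 < s := by
  refine (intervalIntegral.integrableOn_Ioo_rpow_iff ht).1 ⟨by fun_prop, ?_⟩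
  rw [hasFiniteIntegral_iff_ofReal]
  · exact h
  · exact (ae_restrict_mem measurableSet_Ioo).mono fun x hx => Real.rpow_nonneg hx.1.le _

theorem measurePreserving_const_sub (t : ℝ) :
    MeasurePreserving (fun x : ℝ => t - x) volume volume :=
  Measure.measurePreserving_sub_left volume t

theorem setLIntegral_Ioo_const_sub {t u : ℝ} {f : ℝ → ℝ≥0∞} (hf : Measurable f) :
    ∫⁻ x in Set.Ioo (t - u) t, f (t - x) = ∫⁻ x in Set.Ioo 0 u, f x := by
  rw [← (measurePreserving_const_sub t).setLIntegral_comp_preimage measurableSet_Ioo hf]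
  congr 2
  ext x
  simp only [Set.mem_Ioo, Set.mem_preimage]
  constructor <;> rintro ⟨h1, h2⟩ <;> constructor <;> linarith

theorem lintegral_add_abs_rpow_le {c δ : ℝ} (hc : 1 < c) (hδ : 0 < δ) :
    ∫⁻ θ, ENNReal.ofReal ((δ + |θ|) ^ (-c)) ≤ ENNReal.ofReal (2 / (c - 1) * δ ^ (1 - c)) := by
  have hm : Measurable fun x : ℝ => ENNReal.ofReal (x ^ (-c)) := by fun_prop
  have key : ∫⁻ x in Set.Ioi δ, ENNReal.ofReal (x ^ (-c)) ≤ ENNReal.ofReal (δ ^ (1 - c) / (c - 1)) := by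
    have := lintegral_Ioi_rpow_le (c := -c) (by linarith) hδ
    rwa [neg_neg, show -c + 1 = 1 - c by ring] at this
  have h1 : ∫⁻ θ in Set.Ioi (0 : ℝ), ENNReal.ofReal ((δ + |θ|) ^ (-c)) ≤
      ∫⁻ x in Set.Ioi δ, ENNReal.ofReal (x ^ (-c)) := by
    rw [← (measurePreserving_add_left volume δ).setLIntegral_comp_preimage measurableSet_Ioi hm]
    have : (fun x : ℝ => δ + x) ⁻¹' Set.Ioi δ = Set.Ioi 0 := by ext; simp
    rw [this]
    refine (setLIntegral_congr_fun measurableSet_Ioi fun x hx => ?_).le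
    simp only [abs_of_pos (Set.mem_Ioi.1 hx)]
  have h2 : ∫⁻ θ in Set.Iio (0 : ℝ), ENNReal.ofReal ((δ + |θ|) ^ (-c)) ≤
      ∫⁻ x in Set.Ioi δ, ENNReal.ofReal (x ^ (-c)) := by
    rw [← (measurePreserving_const_sub δ).setLIntegral_comp_preimage measurableSet_Ioi hm]
    have : (fun x : ℝ => δ - x) ⁻¹' Set.Ioi δ = Set.Iio 0 := by ext; simp
    rw [this]
    refine (setLIntegral_congr_fun measurableSet_Iio fun x hx => ?_).le
    simp only [abs_of_neg (Set.mem_Iio.1 hx), sub_eq_add_neg]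
  calc ∫⁻ θ, ENNReal.ofReal ((δ + |θ|) ^ (-c))
      = ∫⁻ θ in Set.Iic (0 : ℝ) ∪ Set.Ioi 0, ENNReal.ofReal ((δ + |θ|) ^ (-c)) := by
        rw [Set.Iic_union_Ioi, Measure.restrict_univ]
    _ ≤ ENNReal.ofReal (δ ^ (1 - c) / (c - 1)) + ENNReal.ofReal (δ ^ (1 - c) / (c - 1)) := by
        refine (lintegral_union_le _ _ _).trans (add_le_add ?_ (h1.trans key))
        rw [setLIntegral_congr Iio_ae_eq_Iic.symm]
        exact h2.trans key
    _ = _ := by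
        rw [← ENNReal.ofReal_add (by have := Real.rpow_nonneg hδ.le (1 - c); have : 0 < c - 1 := by linarith
                                     positivity)
          (by have := Real.rpow_nonneg hδ.le (1 - c); have : 0 < c - 1 := by linarith
              positivity)]
        congr 1; ring

/-- With its lower counterpart below, this absorbs factors comparable to 1 into constants, whatever
the sign of the exponent. -/
theorem rpow_le_two_rpow_abs {x s : ℝ} (h1 : 1 / 2 ≤ x) (h2 : x ≤ 2) : x ^ s ≤ 2 ^ |s| := by
  have hx : 0 < x := by linarith
  rcases le_total 0 s with hs | hs
  · rw [abs_of_nonneg hs]; exact Real.rpow_le_rpow hx.le h2 hs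
  · rw [abs_of_nonpos hs, Real.rpow_neg zero_le_two, ← Real.inv_rpow zero_le_two]
    exact Real.rpow_le_rpow_of_nonpos (by norm_num) (by linarith) hs

theorem two_rpow_neg_abs_le_rpow {x s : ℝ} (h1 : 1 / 2 ≤ x) (h2 : x ≤ 2) : 2 ^ (-|s|) ≤ x ^ s := by
  have hx : 0 < x := by linarith
  have := rpow_le_two_rpow_abs (s := -s) h1 h2
  rw [abs_neg, Real.rpow_neg hx.le] at this
  rw [Real.rpow_neg zero_le_two]
  exact inv_le_of_inv_le₀ (Real.rpow_pos_of_pos hx _) this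

theorem norm_one_sub_polar_sq (x θ : ℝ) :
    ‖(1 : ℂ) - x * (Real.cos θ + Real.sin θ * Complex.I)‖ ^ 2 =
      (1 - x) ^ 2 + 2 * x * (1 - Real.cos θ) := by
  rw [← Complex.normSq_eq_norm_sq, Complex.normSq_apply]
  simp
  ring_nf
  simp only [← Complex.ofReal_cos, ← Complex.ofReal_sin, Complex.ofReal_re]
  nlinarith [Real.sin_sq_add_cos_sq θ]

/-- The squared modulus is (1-x)² + 2x(1-cos θ). For x ≤ 1/2 the first term suffices, since |θ| ≤ π
< 7/2 ≤ 7(1-x). For x ≥ 1/2 the second is at least θ²/5, because 1-cos θ ≥ 2θ²/π². The constant 1/8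
serves both cases. -/
theorem le_norm_one_sub_polar {x θ : ℝ} (hx : 0 ≤ x) (hx1 : x < 1) (hθ : |θ| ≤ Real.pi) :
    1 / 8 * ((1 - x) + |θ|) ≤ ‖(1 : ℂ) - x * (Real.cos θ + Real.sin θ * Complex.I)‖ := by
  have h := norm_one_sub_polar_sq x θ
  have hc := Real.cos_le_one_sub_mul_cos_sq hθ
  have hπ := Real.pi_lt_d2
  have hθ0 := abs_nonneg θ
  refine abs_le_of_sq_le_sq' ?_ (norm_nonneg _) |>.2
  rw [h]
  rcases le_total x (1 / 2) with hx2 | hx2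
  · have h1 : |θ| ≤ 7 * (1 - x) := by linarith
    nlinarith [Real.cos_le_one θ]
  · have h2 : 1 / 5 ≤ 2 / Real.pi ^ 2 := by
      rw [div_le_div_iff₀ (by norm_num) (by positivity)]
      nlinarith [Real.pi_pos]
    have h3 : 1 / 5 * θ ^ 2 ≤ 1 - Real.cos θ := by nlinarith [sq_nonneg θ]
    have h4 : 1 / 5 * θ ^ 2 ≤ 2 * x * (1 - Real.cos θ) := by nlinarith [Real.cos_le_one θ]
    nlinarith [sq_abs θ, sq_nonneg (1 - x - |θ|)]

theorem norm_one_sub_polar_le {x θ : ℝ} (hx : 0 ≤ x) (hx1 : x ≤ 1) :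
    ‖(1 : ℂ) - x * (Real.cos θ + Real.sin θ * Complex.I)‖ ≤ (1 - x) + |θ| := by
  have h := norm_one_sub_polar_sq x θ
  have hc := Real.one_sub_sq_div_two_le_cos (x := θ)
  refine abs_le_of_sq_le_sq' ?_ (by positivity) |>.2
  rw [h]
  nlinarith [sq_abs θ, abs_nonneg θ, mul_nonneg (sub_nonneg.2 hx1) (abs_nonneg θ), sq_nonneg θ]

/-! ### The Forelli–Rudin estimate. -/

theorem exists_lintegral_radial_le {γ s t : ℝ} (hγ : -1 < γ) (hs : -1 < s) (ht : 0 < t) :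
    ∃ C : ℝ, 0 < C ∧ ∀ ρ : ℝ, 0 ≤ ρ → ρ < 1 →
      ∫⁻ r in Set.Ioo (0 : ℝ) 1,
        ENNReal.ofReal (r ^ γ * (1 - r ^ 2) ^ s * (1 - r * ρ) ^ (-(1 + s + t))) ≤
      ENNReal.ofReal (C * (1 - ρ) ^ (-t)) := by
  set A : ℝ := 2 ^ |γ| * 2 ^ |s| * 2 ^ |-(1 + s + t)| with hA
  have hA0 : 0 < A := by positivity
  have hγ' : 0 < γ + 1 := by linarith
  have hs' : 0 < s + 1 := by linarith
  refine ⟨A * (1 / (γ + 1) + 1 / (s + 1) + 1 / t), by positivity, fun ρ h0 h1 => ?_⟩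
  set δ : ℝ := 1 - ρ with hδ
  have hδ0 : 0 < δ := by linarith
  have hδ1 : δ ≤ 1 := by linarith
  set F : ℝ → ℝ := fun r => r ^ γ * (1 - r ^ 2) ^ s * (1 - r * ρ) ^ (-(1 + s + t)) with hF
  -- Three regions. For r ≤ 1/2 only r^γ matters. For r > 1-δ one uses 1-rρ ≥ δ and integrates
  -- (1-r)^s. For 1/2 < r ≤ 1-δ one uses 1-rρ ≥ 1-r and integrates (1-r)^{-1-t}. The last two both
  -- give a multiple of δ^{-t}, and the first is bounded by one because δ ≤ 1.
  have hsub : Set.Ioo (0 : ℝ) 1 ⊆ Set.Ioc 0 (1 / 2) ∪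
      ({r | 1 / 2 < r} ∩ Set.Ioo (1 - δ) 1 ∪ {r | 1 / 2 < r ∧ r < 1} ∩ Set.Iic (1 - δ)) := by
    intro r hr
    rcases le_or_gt r (1 / 2) with h | h
    · exact Or.inl ⟨hr.1, h⟩
    · rcases le_or_gt r (1 - δ) with h' | h'
      · exact Or.inr (Or.inr ⟨⟨h, hr.2⟩, h'⟩)
      · exact Or.inr (Or.inl ⟨h, h', hr.2⟩)
  have e1 : ∫⁻ r in Set.Ioc (0 : ℝ) (1 / 2), ENNReal.ofReal (F r) ≤
      ENNReal.ofReal (A * (1 / (γ + 1)) * δ ^ (-t)) := by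
    calc ∫⁻ r in Set.Ioc (0 : ℝ) (1 / 2), ENNReal.ofReal (F r)
        ≤ ∫⁻ r in Set.Ioc (0 : ℝ) (1 / 2), ENNReal.ofReal A * ENNReal.ofReal (r ^ γ) := by
          refine setLIntegral_mono (by fun_prop) fun r hr => ?_
          rw [← ENNReal.ofReal_mul hA0.le]
          apply ENNReal.ofReal_le_ofReal
          have a1 : (1 - r ^ 2) ^ s ≤ 2 ^ |s| :=
            rpow_le_two_rpow_abs (by nlinarith [hr.1, hr.2]) (by nlinarith [hr.1])
          have a2 : (1 - r * ρ) ^ (-(1 + s + t)) ≤ 2 ^ |-(1 + s + t)| :=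
            rpow_le_two_rpow_abs (by nlinarith [hr.1, hr.2]) (by nlinarith [hr.1])
          have a3 : 1 ≤ (2 : ℝ) ^ |γ| := Real.one_le_rpow one_le_two (abs_nonneg _)
          have a4 : 0 ≤ r ^ γ := Real.rpow_nonneg hr.1.le _
          have a5 : 0 ≤ (1 - r * ρ) ^ (-(1 + s + t)) :=
            Real.rpow_nonneg (by nlinarith [hr.1, hr.2]) _
          have a6 : 0 ≤ (1 - r ^ 2) ^ s := Real.rpow_nonneg (by nlinarith [hr.1, hr.2]) _
          calc F r = 1 * r ^ γ * (1 - r ^ 2) ^ s * (1 - r * ρ) ^ (-(1 + s + t)) := by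
                rw [one_mul]
            _ ≤ 2 ^ |γ| * r ^ γ * 2 ^ |s| * 2 ^ |-(1 + s + t)| := by gcongr
            _ = A * r ^ γ := by rw [hA]; ring
      _ ≤ ∫⁻ r in Set.Ioo (0 : ℝ) 1, ENNReal.ofReal A * ENNReal.ofReal (r ^ γ) :=
          lintegral_mono_set fun r hr => ⟨hr.1, by linarith [hr.2]⟩
      _ ≤ ENNReal.ofReal A * ENNReal.ofReal (1 ^ (γ + 1) / (γ + 1)) := by
          rw [lintegral_const_mul _ (by fun_prop)]
          gcongr
          exact lintegral_Ioo_rpow_le hγ one_pos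
      _ ≤ _ := by
          rw [← ENNReal.ofReal_mul hA0.le, Real.one_rpow]
          apply ENNReal.ofReal_le_ofReal
          exact le_mul_of_one_le_right (by positivity)
            (Real.one_le_rpow_of_pos_of_le_one_of_nonpos hδ0 hδ1 (by linarith))
  have bd : ∀ r : ℝ, 1 / 2 < r → r < 1 → F r ≤ A * ((1 - r) ^ s * (1 - r * ρ) ^ (-(1 + s + t))) := by
    intro r hr hr1
    have a1 : (1 + r) ^ s ≤ 2 ^ |s| := rpow_le_two_rpow_abs (by linarith) (by linarith)
    have a2 : r ^ γ ≤ 2 ^ |γ| := rpow_le_two_rpow_abs hr.le (by linarith)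
    have a3 : 1 ≤ (2 : ℝ) ^ |-(1 + s + t)| := Real.one_le_rpow one_le_two (abs_nonneg _)
    have a4 : 0 ≤ (1 - r * ρ) ^ (-(1 + s + t)) := Real.rpow_nonneg (by nlinarith) _
    have a5 : 0 ≤ (1 - r) ^ s := Real.rpow_nonneg (by linarith) _
    have a6 : (1 - r ^ 2) ^ s = (1 - r) ^ s * (1 + r) ^ s := by
      rw [← Real.mul_rpow (by linarith) (by linarith)]; ring_nf
    calc F r = r ^ γ * (1 + r) ^ s * 1 * ((1 - r) ^ s * (1 - r * ρ) ^ (-(1 + s + t))) := by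
          simp only [hF]; rw [a6]; ring
      _ ≤ 2 ^ |γ| * 2 ^ |s| * 2 ^ |-(1 + s + t)| *
          ((1 - r) ^ s * (1 - r * ρ) ^ (-(1 + s + t))) := by gcongr
  have e2 : ∫⁻ r in {r | 1 / 2 < r} ∩ Set.Ioo (1 - δ) 1, ENNReal.ofReal (F r) ≤
      ENNReal.ofReal (A * (1 / (s + 1)) * δ ^ (-t)) := by
    calc ∫⁻ r in {r | 1 / 2 < r} ∩ Set.Ioo (1 - δ) 1, ENNReal.ofReal (F r)
        ≤ ∫⁻ r in {r | 1 / 2 < r} ∩ Set.Ioo (1 - δ) 1,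
            ENNReal.ofReal (A * δ ^ (-(1 + s + t))) * ENNReal.ofReal ((1 - r) ^ s) := by
          refine setLIntegral_mono (by fun_prop) fun r ⟨hr, hr'⟩ => ?_
          rw [← ENNReal.ofReal_mul (by positivity)]
          apply ENNReal.ofReal_le_ofReal
          refine (bd r hr hr'.2).trans ?_
          have : (1 - r * ρ) ^ (-(1 + s + t)) ≤ δ ^ (-(1 + s + t)) :=
            Real.rpow_le_rpow_of_nonpos hδ0 (by nlinarith [hr'.2]) (by linarith)
          have a5 : 0 ≤ (1 - r) ^ s := Real.rpow_nonneg (by linarith [hr'.2]) _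
          calc _ ≤ A * ((1 - r) ^ s * δ ^ (-(1 + s + t))) := by gcongr
            _ = _ := by ring
      _ ≤ ∫⁻ r in Set.Ioo (1 - δ) 1,
            ENNReal.ofReal (A * δ ^ (-(1 + s + t))) * ENNReal.ofReal ((1 - r) ^ s) :=
          lintegral_mono_set Set.inter_subset_right
      _ ≤ ENNReal.ofReal (A * δ ^ (-(1 + s + t))) * ENNReal.ofReal (δ ^ (s + 1) / (s + 1)) := by
          rw [lintegral_const_mul _ (by fun_prop)]
          gcongr
          rw [setLIntegral_Ioo_const_sub (f := fun x => ENNReal.ofReal (x ^ s)) (by fun_prop)]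
          exact lintegral_Ioo_rpow_le hs hδ0
      _ = _ := by
          rw [← ENNReal.ofReal_mul (by positivity)]
          congr 1
          have : δ ^ (-t) = δ ^ (-(1 + s + t)) * δ ^ (s + 1) := by
            rw [← Real.rpow_add hδ0]; ring_nf
          rw [this]; ring
  have e3 : ∫⁻ r in {r | 1 / 2 < r ∧ r < 1} ∩ Set.Iic (1 - δ), ENNReal.ofReal (F r) ≤
      ENNReal.ofReal (A * (1 / t) * δ ^ (-t)) := by
    calc ∫⁻ r in {r | 1 / 2 < r ∧ r < 1} ∩ Set.Iic (1 - δ), ENNReal.ofReal (F r)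
        ≤ ∫⁻ r in {r | 1 / 2 < r ∧ r < 1} ∩ Set.Iic (1 - δ),
            ENNReal.ofReal A * ENNReal.ofReal ((1 - r) ^ (-1 - t)) := by
          refine setLIntegral_mono (by fun_prop) fun r ⟨hr, hr'⟩ => ?_
          rw [← ENNReal.ofReal_mul (by positivity)]
          apply ENNReal.ofReal_le_ofReal
          refine (bd r hr.1 hr.2).trans ?_
          have hr1 : 0 < 1 - r := by linarith [hr.2]
          have : (1 - r * ρ) ^ (-(1 + s + t)) ≤ (1 - r) ^ (-(1 + s + t)) :=
            Real.rpow_le_rpow_of_nonpos hr1 (by nlinarith [hr.1]) (by linarith)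
          calc _ ≤ A * ((1 - r) ^ s * (1 - r) ^ (-(1 + s + t))) := by gcongr
            _ = _ := by rw [← Real.rpow_add hr1]; ring_nf
      _ ≤ ∫⁻ r in Set.Iic (1 - δ), ENNReal.ofReal A * ENNReal.ofReal ((1 - r) ^ (-1 - t)) :=
          lintegral_mono_set Set.inter_subset_right
      _ ≤ ENNReal.ofReal A * ENNReal.ofReal (δ ^ (-1 - t + 1) / (-(-1 - t) - 1)) := by
          rw [lintegral_const_mul _ (by fun_prop)]
          gcongr
          refine le_trans (le_of_eq ?_) (lintegral_Ioi_rpow_le (by linarith) hδ0)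
          rw [setLIntegral_congr Iio_ae_eq_Iic.symm,
            ← (measurePreserving_const_sub 1).setLIntegral_comp_preimage measurableSet_Ioi
              (by fun_prop)]
          congr 2
          ext x
          simp only [Set.mem_Iio, Set.mem_preimage, Set.mem_Ioi]
          constructor <;> intro <;> linarith
      _ = _ := by
          rw [← ENNReal.ofReal_mul (by positivity)]
          congr 1
          rw [show -1 - t + 1 = -t by ring, show -(-1 - t) - 1 = t by ring]
          ring
  calc _ ≤ _ := lintegral_mono_set hsub
    _ ≤ _ := (lintegral_union_le _ _ _).trans
        (add_le_add e1 ((lintegral_union_le _ _ _).trans (add_le_add e2 e3)))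
    _ = _ := by
        rw [← ENNReal.ofReal_add (by positivity) (by positivity),
          ← ENNReal.ofReal_add (by positivity) (by positivity)]
        congr 1; ring

/-- Integration over the unit disc in polar coordinates. -/
theorem lintegral_unitDisc_polar {F : ℂ → ℝ≥0∞} (hF : Measurable F) :
    ∫⁻ z in unitDisc, F z = ∫⁻ r in Set.Ioo (0 : ℝ) 1, ∫⁻ θ in Set.Ioo (-Real.pi) Real.pi,
      ENNReal.ofReal r * F (r * (Real.cos θ + Real.sin θ * Complex.I)) := by
  have hmp : Measurable fun p : ℝ × ℝ =>
      (p.1 : ℂ) * (Real.cos p.2 + Real.sin p.2 * Complex.I) := by fun_prop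
  have hD : MeasurableSet unitDisc := measurableSet_ball
  rw [← lintegral_indicator hD, ← Complex.lintegral_comp_polarCoord_symm]
  simp only [Complex.polarCoord_symm_apply, smul_eq_mul, polarCoord_target]
  rw [Measure.volume_eq_prod, ← Measure.prod_restrict, lintegral_prod]
  · rw [show Set.Ioo (0 : ℝ) 1 = Set.Iio 1 ∩ Set.Ioi 0 by rw [Set.inter_comm]; rfl, ← Measure.restrict_restrict measurableSet_Iio,
      ← lintegral_indicator (measurableSet_Iio (a := (1 : ℝ)))]
    refine setLIntegral_congr_fun measurableSet_Ioi fun r hr => ?_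
    have hr' : |r| = r := abs_of_pos hr
    by_cases h1 : r < 1 <;> simp [Set.indicator, unitDisc, h1, hr']
  · exact ((by fun_prop : Measurable fun p : ℝ × ℝ => ENNReal.ofReal p.1).mul
      ((hF.indicator hD).comp hmp)).aemeasurable

theorem measurableSet_unitDisc : MeasurableSet unitDisc := measurableSet_ball

theorem mem_unitDisc {z : ℂ} : z ∈ unitDisc ↔ ‖z‖ < 1 := by simp [unitDisc]

theorem norm_polar {r : ℝ} (hr : 0 ≤ r) (θ : ℝ) :
    ‖(r : ℂ) * (Real.cos θ + Real.sin θ * Complex.I)‖ = r := by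
  rw [norm_mul, Complex.ofReal_cos, Complex.ofReal_sin, Complex.norm_cos_add_sin_mul_I,
    Complex.norm_real, mul_one, Real.norm_of_nonneg hr]

/-- Writing w = u‖w‖ with |u| = 1, the substitution z ↦ uz preserves the disc and Lebesgue measure.
This reduces `forelli_rudin` to real w ≥ 0. -/
theorem lintegral_unitDisc_rotate (F : ℂ → ℂ → ℝ≥0∞) (hF : ∀ w, Measurable fun z => F z w)
    (h : ∀ u z w : ℂ, ‖u‖ = 1 → F (u * z) (u * w) = F z w) (w : ℂ) :
    ∫⁻ z in unitDisc, F z w = ∫⁻ z in unitDisc, F z (‖w‖ : ℂ) := by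
  obtain ⟨u, hw⟩ : ∃ u : Circle, w = u * (‖w‖ : ℂ) := by
    rcases eq_or_ne w 0 with rfl | hw
    · exact ⟨1, by simp⟩
    · have hw' : (‖w‖ : ℂ) ≠ 0 := by simpa using hw
      exact ⟨⟨w / ‖w‖, by simp [Submonoid.unitSphere, norm_ne_zero_iff.2 hw]⟩,
        (div_mul_cancel₀ _ hw').symm⟩
  have hp := (rotation u).measurePreserving
  have hpre : (rotation u) ⁻¹' unitDisc = unitDisc := by
    ext z; simp only [Set.mem_preimage, mem_unitDisc, LinearIsometryEquiv.norm_map]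
  rw [← hp.setLIntegral_comp_preimage measurableSet_unitDisc (hF w), hpre]
  refine lintegral_congr fun z => ?_
  conv_lhs => rw [hw]
  rw [rotation_apply, h _ _ _ u.norm_coe]

/-- The Forelli–Rudin estimate in the unit disc with a power weight at the origin. -/
theorem forelli_rudin {β s t : ℝ} (hβ : -2 < β) (hs : -1 < s) (ht : 0 < t) :
    ∃ C : ℝ, 0 < C ∧ ∀ w ∈ unitDisc,
      ∫⁻ z in unitDisc, ENNReal.ofReal (‖z‖ ^ β * (1 - ‖z‖ ^ 2) ^ s *
        ‖1 - z * starRingEnd ℂ w‖ ^ (-(2 + s + t))) ≤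
      ENNReal.ofReal (C * (1 - ‖w‖ ^ 2) ^ (-t)) := by
  obtain ⟨C, hC, h⟩ := exists_lintegral_radial_le (γ := β + 1) (by linarith) hs ht
  have hc : 0 < 1 + s + t := by linarith
  set c := 2 + s + t with hcdef
  set A : ℝ := (1 / 8) ^ (-c) * (2 / (c - 1)) with hA
  have hc1 : 1 < c := by linarith
  have hA0 : 0 < A := by have : 0 < c - 1 := by linarith
                         positivity
  -- A collects the angular integral, C the radial one, and 2^t pays for replacing (1-ρ)^{-t} by
  -- (1-ρ²)^{-t}.
  refine ⟨A * C * 2 ^ t, by positivity, fun w hw => ?_⟩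
  rw [mem_unitDisc] at hw
  rw [lintegral_unitDisc_rotate (fun z w => ENNReal.ofReal (‖z‖ ^ β * (1 - ‖z‖ ^ 2) ^ s *
        ‖1 - z * starRingEnd ℂ w‖ ^ (-c))) (fun w => by fun_prop)
        (fun u z w hu => by
          have : u * z * starRingEnd ℂ (u * w) = z * starRingEnd ℂ w := by
            rw [map_mul]
            calc _ = (u * starRingEnd ℂ u) * (z * starRingEnd ℂ w) := by ring
              _ = _ := by rw [Complex.mul_conj, Complex.normSq_eq_norm_sq, hu]; simp
          simp only [norm_mul, hu, one_mul, this])]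
  rw [lintegral_unitDisc_polar (by fun_prop)]
  set ρ := ‖w‖ with hρ
  have hρ0 : 0 ≤ ρ := norm_nonneg w
  calc _ ≤ ∫⁻ r in Set.Ioo (0 : ℝ) 1, ENNReal.ofReal A * ENNReal.ofReal
        (r ^ (β + 1) * (1 - r ^ 2) ^ s * (1 - r * ρ) ^ (-(1 + s + t))) := by
        refine setLIntegral_mono (by fun_prop) fun r hr => ?_
        have hrρ : 0 ≤ r * ρ := mul_nonneg hr.1.le hρ0
        have hrρ1 : r * ρ < 1 := by nlinarith [hr.1, hr.2]
        have n0 : 0 ≤ (1 - r ^ 2) ^ s := Real.rpow_nonneg (by nlinarith [hr.1, hr.2]) _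
        have n1 : 0 ≤ r ^ (β + 1) := Real.rpow_nonneg hr.1.le _
        have n2 : 0 ≤ (1 - r * ρ) ^ (-(1 + s + t)) := Real.rpow_nonneg (by linarith) _
        -- Integrating (1-rρ+|θ|)^{-c} in θ gains one power of 1-rρ; the Jacobian r turns r^β into
        -- r^{β+1}, whence the hypothesis β > -2.
        calc _ ≤ ∫⁻ θ in Set.Ioo (-Real.pi) Real.pi,
                ENNReal.ofReal (r ^ (β + 1) * (1 - r ^ 2) ^ s * (1 / 8) ^ (-c)) *
                  ENNReal.ofReal ((1 - r * ρ + |θ|) ^ (-c)) := by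
              refine setLIntegral_mono (by fun_prop) fun θ hθ => ?_
              rw [← ENNReal.ofReal_mul hr.1.le, ← ENNReal.ofReal_mul (by positivity)]
              apply ENNReal.ofReal_le_ofReal
              rw [norm_polar hr.1.le, Complex.conj_ofReal]
              have hl := le_norm_one_sub_polar hrρ hrρ1 (abs_le.2 ⟨hθ.1.le, hθ.2.le⟩)
              have hpos : 0 < 1 - r * ρ + |θ| := by have := abs_nonneg θ; linarith
              have hl2 := Real.rpow_le_rpow_of_nonpos (by positivity) hl
                (show -c ≤ 0 by linarith)
              rw [Real.mul_rpow (by norm_num) hpos.le] at hl2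
              rw [show (1 : ℂ) - r * (Real.cos θ + Real.sin θ * Complex.I) * (ρ : ℂ) =
                1 - ((r * ρ : ℝ) : ℂ) * (Real.cos θ + Real.sin θ * Complex.I) by push_cast; ring]
              calc _ = r ^ (β + 1) * (1 - r ^ 2) ^ s * ‖1 - ((r * ρ : ℝ) : ℂ) *
                        (Real.cos θ + Real.sin θ * Complex.I)‖ ^ (-c) := by
                    rw [Real.rpow_add_one hr.1.ne']; ring
                _ ≤ r ^ (β + 1) * (1 - r ^ 2) ^ s *
                      ((1 / 8) ^ (-c) * (1 - r * ρ + |θ|) ^ (-c)) := by gcongr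
                _ = _ := by ring
          _ ≤ ENNReal.ofReal (r ^ (β + 1) * (1 - r ^ 2) ^ s * (1 / 8) ^ (-c)) *
                ENNReal.ofReal (2 / (c - 1) * (1 - r * ρ) ^ (1 - c)) := by
              rw [lintegral_const_mul _ (by fun_prop)]
              gcongr
              exact (setLIntegral_le_lintegral _ _).trans
                (lintegral_add_abs_rpow_le hc1 (by linarith))
          _ = _ := by
              rw [← ENNReal.ofReal_mul (by positivity), ← ENNReal.ofReal_mul (by positivity)]
              congr 1
              rw [show 1 - c = -(1 + s + t) by rw [hcdef]; ring, hA]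
              ring
    _ ≤ ENNReal.ofReal A * ENNReal.ofReal (C * (1 - ρ) ^ (-t)) := by
        rw [lintegral_const_mul _ (by fun_prop)]
        gcongr
        exact h ρ hρ0 hw
    _ ≤ _ := by
        rw [← ENNReal.ofReal_mul hA0.le]
        apply ENNReal.ofReal_le_ofReal
        have : (1 - ρ) ^ (-t) ≤ 2 ^ t * (1 - ρ ^ 2) ^ (-t) := by
          have h1 : 0 < 1 - ρ := by linarith
          have := Real.rpow_le_rpow_of_nonpos (x := (1 - ρ ^ 2) / 2) (y := 1 - ρ)
            (by nlinarith) (by nlinarith) (show -t ≤ 0 by linarith)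
          rw [Real.div_rpow (by nlinarith) zero_le_two, Real.rpow_neg zero_le_two,
            div_inv_eq_mul] at this
          linarith
        calc _ ≤ A * (C * (2 ^ t * (1 - ρ ^ 2) ^ (-t))) := by gcongr
          _ = _ := by ring

/-! ### Divergent integrals on the disc. -/

/-- In polar coordinates the range r < 1/2 detects β and the range r > 1/2 detects s, the other
factor being comparable to 1 in each. -/
theorem exponents_of_lintegral_unitDisc_lt_top {β s : ℝ}
    (h : ∫⁻ z in unitDisc, ENNReal.ofReal (‖z‖ ^ β * (1 - ‖z‖ ^ 2) ^ s) < ∞) :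
    -2 < β ∧ -1 < s := by
  rw [lintegral_unitDisc_polar (by fun_prop)] at h
  have h2 : ∫⁻ r in Set.Ioo (0 : ℝ) 1, ENNReal.ofReal (r ^ (β + 1) * (1 - r ^ 2) ^ s) < ∞ := by
    have e : ∫⁻ r in Set.Ioo (0 : ℝ) 1, ENNReal.ofReal (2 * Real.pi) *
        ENNReal.ofReal (r ^ (β + 1) * (1 - r ^ 2) ^ s) < ∞ := by
      refine lt_of_eq_of_lt ?_ h
      refine setLIntegral_congr_fun measurableSet_Ioo fun r hr => ?_
      simp only [norm_polar hr.1.le]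
      rw [setLIntegral_const, Real.volume_Ioo, ← ENNReal.ofReal_mul hr.1.le,
        Real.rpow_add_one hr.1.ne', mul_comm]
      congr 2 <;> ring
    rw [lintegral_const_mul _ (by fun_prop)] at e
    refine lt_of_le_of_ne le_top fun h' => ?_
    rw [h', ENNReal.mul_top] at e
    · exact lt_irrefl _ e
    · simp [Real.pi_pos]
  constructor
  · have := neg_one_lt_of_lintegral_Ioo_rpow_lt_top (s := β + 1) (t := 1 / 2) (by norm_num) ?_
    · linarith
    have e : ENNReal.ofReal (2 ^ (-|s|)) *
        ∫⁻ r in Set.Ioo (0 : ℝ) (1 / 2), ENNReal.ofReal (r ^ (β + 1)) < ∞ := by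
      refine lt_of_le_of_lt ?_ h2
      rw [← lintegral_const_mul _ (by fun_prop)]
      refine (setLIntegral_mono (by fun_prop) fun r hr => ?_).trans
        (lintegral_mono_set (Set.Ioo_subset_Ioo_right (by norm_num)))
      rw [← ENNReal.ofReal_mul (by positivity), mul_comm]
      apply ENNReal.ofReal_le_ofReal
      have n1 : 0 ≤ r ^ (β + 1) := Real.rpow_nonneg hr.1.le _
      gcongr
      exact two_rpow_neg_abs_le_rpow (by nlinarith [hr.1, hr.2]) (by nlinarith [hr.1, hr.2])
    refine lt_of_le_of_ne le_top fun h' => ?_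
    rw [h', ENNReal.mul_top (by simp; positivity)] at e
    exact lt_irrefl _ e
  · refine neg_one_lt_of_lintegral_Ioo_rpow_lt_top (s := s) (t := 1 / 2) (by norm_num) ?_
    have e : ENNReal.ofReal (2 ^ (-|β + 1|) * 2 ^ (-|s|)) *
        ∫⁻ r in Set.Ioo (0 : ℝ) (1 / 2), ENNReal.ofReal (r ^ s) < ∞ := by
      refine lt_of_le_of_lt ?_ h2
      rw [← setLIntegral_Ioo_const_sub (t := 1) (f := fun x => ENNReal.ofReal (x ^ s))
        (by fun_prop), ← lintegral_const_mul _ (by fun_prop)]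
      refine (setLIntegral_mono (by fun_prop) fun r hr => ?_).trans
        (lintegral_mono_set (Set.Ioo_subset_Ioo_left (by norm_num)))
      obtain ⟨hr1, hr2⟩ := hr
      rw [← ENNReal.ofReal_mul (by positivity)]
      apply ENNReal.ofReal_le_ofReal
      have n1 : 0 ≤ (1 - r) ^ s := Real.rpow_nonneg (by linarith) _
      have n2 : 0 ≤ r ^ (β + 1) := Real.rpow_nonneg (by linarith) _
      have a6 : (1 - r ^ 2) ^ s = (1 + r) ^ s * (1 - r) ^ s := by
        rw [← Real.mul_rpow (by linarith) (by linarith)]; ring_nf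
      rw [a6, ← mul_assoc]
      gcongr
      · exact two_rpow_neg_abs_le_rpow (by linarith) (by linarith)
      · exact two_rpow_neg_abs_le_rpow (by linarith) (by linarith)
    refine lt_of_le_of_ne le_top fun h' => ?_
    rw [h', ENNReal.mul_top (by simp; positivity)] at e
    exact lt_irrefl _ e

/-- On the region 1/2 < r < 1, 0 < θ < 1-r one has |1-z| ≤ 2(1-r), so the integrand is at least a
multiple of (1-r)^{-2}. The angular width 1-r leaves ∫ dr/(1-r) = ∞. -/
theorem lintegral_unitDisc_critical_eq_top {β a : ℝ} (ha : -2 < a) :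
    ∫⁻ z in unitDisc, ENNReal.ofReal (‖z‖ ^ β * (1 - ‖z‖ ^ 2) ^ a * ‖1 - z‖ ^ (-(2 + a))) = ∞ := by
  by_contra hne
  have h := lt_top_iff_ne_top.2 hne
  rw [lintegral_unitDisc_polar (by fun_prop)] at h
  have := neg_one_lt_of_lintegral_Ioo_rpow_lt_top (s := -1) (t := 1 / 2) (by norm_num) ?_
  · exact lt_irrefl _ this
  have e : ENNReal.ofReal (2 ^ (-|β + 1|) * 2 ^ (-|a|) * 2 ^ (-(2 + a))) *
      ∫⁻ r in Set.Ioo (0 : ℝ) (1 / 2), ENNReal.ofReal (r ^ (-1 : ℝ)) < ∞ := by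
    refine lt_of_le_of_lt ?_ h
    rw [← setLIntegral_Ioo_const_sub (t := 1) (f := fun x => ENNReal.ofReal (x ^ (-1 : ℝ)))
      (by fun_prop), ← lintegral_const_mul _ (by fun_prop)]
    refine le_trans ?_ (lintegral_mono_set (Set.Ioo_subset_Ioo_left (by norm_num :
      (0 : ℝ) ≤ 1 - 1 / 2)))
    refine setLIntegral_mono' measurableSet_Ioo fun r ⟨hr1, hr2⟩ => ?_
    have hsub : Set.Ioo 0 (1 - r) ⊆ Set.Ioo (-Real.pi) Real.pi := fun θ hθ =>
      ⟨by linarith [hθ.1, Real.pi_pos], by linarith [hθ.2, Real.pi_gt_three]⟩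
    refine le_trans ?_ (lintegral_mono_set hsub)
    calc _ = ∫⁻ θ in Set.Ioo 0 (1 - r), ENNReal.ofReal
            (2 ^ (-|β + 1|) * 2 ^ (-|a|) * 2 ^ (-(2 + a)) * (1 - r) ^ (-2 : ℝ)) := by
          rw [setLIntegral_const, Real.volume_Ioo, ← ENNReal.ofReal_mul (by positivity),
            ← ENNReal.ofReal_mul (by
              have := Real.rpow_nonneg (show 0 ≤ 1 - r by linarith) (-2 : ℝ); positivity),
            mul_assoc _ ((1 - r) ^ (-2 : ℝ)), sub_zero, ← Real.rpow_add_one (by linarith)]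
          norm_num
      _ ≤ _ := by
          refine setLIntegral_mono (by fun_prop) fun θ ⟨hθ1, hθ2⟩ => ?_
          rw [← ENNReal.ofReal_mul (by linarith), norm_polar (by linarith)]
          apply ENNReal.ofReal_le_ofReal
          have n1 : 0 ≤ (1 - r) ^ a := Real.rpow_nonneg (by linarith) _
          have n2 : 0 ≤ r ^ (β + 1) := Real.rpow_nonneg (by linarith) _
          have n3 : 0 ≤ (1 - r) ^ (-(2 + a)) := Real.rpow_nonneg (by linarith) _
          have a6 : (1 - r ^ 2) ^ a = (1 + r) ^ a * (1 - r) ^ a := by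
            rw [← Real.mul_rpow (by linarith) (by linarith)]; ring_nf
          have hu := norm_one_sub_polar_le (x := r) (θ := θ) (by linarith) (by linarith)
          rw [abs_of_pos hθ1] at hu
          have hl := le_norm_one_sub_polar (x := r) (θ := θ) (by linarith) (by linarith)
            (by rw [abs_of_pos hθ1]; linarith [Real.pi_gt_three])
          rw [abs_of_pos hθ1] at hl
          have b := Real.rpow_le_rpow_of_nonpos (z := -(2 + a))
            (y := 2 * (1 - r)) (by linarith) (by linarith) (by linarith :  -(2 + a) ≤ 0)
          rw [Real.mul_rpow zero_le_two (by linarith)] at b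
          calc _ = 2 ^ (-|β + 1|) * (2 ^ (-|a|) * (1 - r) ^ a) *
                  (2 ^ (-(2 + a)) * (1 - r) ^ (-(2 + a))) := by
                rw [show (-2 : ℝ) = a + -(2 + a) by ring, Real.rpow_add (by linarith)]
                ring
            _ ≤ r ^ (β + 1) * ((1 + r) ^ a * (1 - r) ^ a) *
                 ‖(1 : ℂ) - r * (Real.cos θ + Real.sin θ * Complex.I)‖ ^ (-(2 + a)) := by
                gcongr
                · exact two_rpow_neg_abs_le_rpow (by linarith) (by linarith)
                · exact two_rpow_neg_abs_le_rpow (by linarith) (by linarith)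
            _ = _ := by rw [a6, Real.rpow_add_one (by linarith)]; ring
  refine lt_of_le_of_ne le_top fun h' => ?_
  rw [h', ENNReal.mul_top (by simp; positivity)] at e
  exact lt_irrefl _ e

/-! ### The measure μ_{a,b} and the common modulus of the kernels. -/

/-- The normalizing constant of `diskMeasure a b` with respect to Lebesgue measure. -/
noncomputable def diskConst (a b : ℝ) : ℝ :=
  1 / Real.pi * (1 / ProbabilityTheory.beta (a + 1) (b + 1))

theorem diskConst_pos {a b : ℝ} (ha : -1 < a) (hb : -1 < b) : 0 < diskConst a b := by
  have := ProbabilityTheory.beta_pos (α := a + 1) (β := b + 1) (by linarith) (by linarith)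
  have := Real.pi_pos
  unfold diskConst
  positivity

theorem diskMeasure_absolutelyContinuous (a b : ℝ) :
    diskMeasure a b ≪ (volume : Measure ℂ).restrict unitDisc :=
  (withDensity_absolutelyContinuous _ _).trans Measure.smul_absolutelyContinuous

theorem ae_diskMeasure (a b : ℝ) : ∀ᵐ z ∂diskMeasure a b, ‖z‖ < 1 ∧ z ≠ 0 := by
  refine (diskMeasure_absolutelyContinuous a b).ae_le ?_
  filter_upwards [ae_restrict_mem measurableSet_unitDisc,
    ae_restrict_of_ae (Measure.ae_ne volume (0 : ℂ))] with z h1 h2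
  exact ⟨mem_unitDisc.1 h1, h2⟩

theorem lintegral_diskMeasure {a b : ℝ} (ha : -1 < a) (hb : -1 < b) {F : ℂ → ℝ≥0∞}
    (hF : Measurable F) :
    ∫⁻ z, F z ∂diskMeasure a b = ENNReal.ofReal (diskConst a b) *
      ∫⁻ z in unitDisc, ENNReal.ofReal (‖z‖ ^ (2 * b) * (1 - ‖z‖ ^ 2) ^ a) * F z := by
  have hB := ProbabilityTheory.beta_pos (α := a + 1) (β := b + 1) (by linarith) (by linarith)
  have hm : Measurable fun z : ℂ => ENNReal.ofReal
      (1 / ProbabilityTheory.beta (a + 1) (b + 1) * ‖z‖ ^ (2 * b) * (1 - ‖z‖ ^ 2) ^ a) := by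
    fun_prop
  rw [diskMeasure, lintegral_withDensity_eq_lintegral_mul _ hm hF, areaMeasure,
    lintegral_smul_measure, smul_eq_mul, diskConst, ENNReal.ofReal_mul (by positivity), mul_assoc]
  congr 1
  rw [← lintegral_const_mul _ (by fun_prop)]
  refine lintegral_congr fun z => ?_
  rw [Pi.mul_apply, mul_assoc, ENNReal.ofReal_mul (by positivity), mul_assoc]

/-- X and Y are the exponents beyond those already in the density of μ_{a,b}. Keeping e as a
variable tied by an equation lets it be instantiated directly at 2 + α. -/
theorem diskMeasure_forelli_rudin {a b : ℝ} (ha : -1 < a) (hb : -1 < b) {X Y t e : ℝ}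
    (hX : -2 < 2 * b + X) (hY : -1 < a + Y) (ht : 0 < t) (he : e = 2 + (a + Y) + t) :
    ∃ C : ℝ, 0 < C ∧ ∀ w : ℂ, ‖w‖ < 1 →
      ∫⁻ z, ENNReal.ofReal (‖z‖ ^ X * (1 - ‖z‖ ^ 2) ^ Y * ‖1 - z * starRingEnd ℂ w‖ ^ (-e))
        ∂diskMeasure a b ≤ ENNReal.ofReal (C * (1 - ‖w‖ ^ 2) ^ (-t)) := by
  obtain ⟨C, hC, h⟩ := forelli_rudin hX hY ht
  have hκ := diskConst_pos ha hb
  refine ⟨diskConst a b * C, by positivity, fun w hw => ?_⟩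
  rw [lintegral_diskMeasure ha hb (by fun_prop), mul_assoc, ENNReal.ofReal_mul hκ.le]
  gcongr
  refine le_trans (le_of_eq ?_) (h w (mem_unitDisc.2 hw))
  refine lintegral_congr_ae ?_
  filter_upwards [ae_restrict_mem measurableSet_unitDisc,
    ae_restrict_of_ae (Measure.ae_ne volume (0 : ℂ))] with z h1 h2
  rw [mem_unitDisc] at h1
  have hz : 0 < ‖z‖ := norm_pos_iff.2 h2
  have hz1 : 0 < 1 - ‖z‖ ^ 2 := by nlinarith
  rw [← ENNReal.ofReal_mul (by positivity), Real.rpow_add hz, Real.rpow_add hz1, he]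
  congr 1; ring

theorem isFiniteMeasure_diskMeasure {a b : ℝ} (ha : -1 < a) (hb : -1 < b) :
    IsFiniteMeasure (diskMeasure a b) := by
  obtain ⟨C, -, h⟩ := diskMeasure_forelli_rudin ha hb (X := 0) (Y := 0) (by linarith)
    (by linarith) one_pos rfl
  refine ⟨?_⟩
  -- At w = 0 with X = Y = 0 the Forelli–Rudin integral is the total mass.
  have := h 0 (by simp)
  simp only [Real.rpow_zero, map_zero, mul_zero, sub_zero, norm_one, Real.one_rpow, mul_one,
    ENNReal.ofReal_one, lintegral_one] at this
  exact this.trans_lt ENNReal.ofReal_lt_top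

/-- The common absolute value of the kernels `kernelT` and `kernelS`. -/
noncomputable def absKernel (α a b : ℝ) (m : ℕ) (z w : ℂ) : ℝ :=
  ‖z‖ ^ (-(m : ℝ)) * ((1 - ‖w‖ ^ 2) ^ (α - a) * ‖w‖ ^ ((m : ℝ) - 2 * b) *
    ‖1 - z * starRingEnd ℂ w‖ ^ (-(2 + α)))

theorem absKernel_nonneg (α a b : ℝ) (m : ℕ) (z : ℂ) {w : ℂ} (hw : ‖w‖ < 1) :
    0 ≤ absKernel α a b m z w := by
  have : 0 < 1 - ‖w‖ ^ 2 := by nlinarith [norm_nonneg w]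
  unfold absKernel
  positivity

theorem measurable_absKernel (α a b : ℝ) (m : ℕ) :
    Measurable (Function.uncurry (absKernel α a b m)) := by
  unfold absKernel Function.uncurry
  fun_prop

theorem kernelS_eq (α a b : ℝ) (m : ℕ) (z w : ℂ) :
    kernelS α a b m z w = (absKernel α a b m z w : ℂ) := by
  unfold kernelS absKernel
  rw [Real.rpow_neg (norm_nonneg _), Real.rpow_neg (norm_nonneg _), Real.rpow_natCast, one_div,
    div_eq_mul_inv]

theorem norm_kernelT {α a b : ℝ} {m : ℕ} {z w : ℂ} (hw : ‖w‖ < 1) (hw0 : w ≠ 0) :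
    ‖kernelT α a b m z w‖ = absKernel α a b m z w := by
  have h1 : 0 < 1 - ‖w‖ ^ 2 := by nlinarith [norm_nonneg w]
  have h2 : 0 < ‖w‖ := norm_pos_iff.2 hw0
  unfold kernelT absKernel
  rw [norm_mul, norm_div, norm_div, norm_mul, norm_mul, Complex.norm_cpow_real, norm_pow, norm_pow,
    Complex.norm_real, Complex.norm_real, Real.norm_of_nonneg (by positivity),
    Real.norm_of_nonneg (by positivity), norm_one,
    Real.rpow_neg (norm_nonneg _), Real.rpow_neg (norm_nonneg _), Real.rpow_natCast,
    Real.rpow_sub h2, Real.rpow_natCast]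
  field_simp

theorem measurable_kernelT (α a b : ℝ) (m : ℕ) :
    Measurable (Function.uncurry (kernelT α a b m)) := by
  unfold kernelT Function.uncurry
  fun_prop

theorem measurable_kernelS (α a b : ℝ) (m : ℕ) :
    Measurable (Function.uncurry (kernelS α a b m)) := by
  have : Function.uncurry (kernelS α a b m) =
      fun p => ((Function.uncurry (absKernel α a b m) p : ℝ) : ℂ) := by
    ext p; exact kernelS_eq ..
  rw [this]
  exact Complex.measurable_ofReal.comp (measurable_absKernel ..)

/-! ### Boundedness through nonnegative integrals, and Schur's test. -/

/-- A bound for the integral of |f||K| contains everything: its finiteness almost everywhere is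
absolute convergence, and the triangle inequality gives the norm bound. -/
theorem isBoundedOnLp_of_lintegral_le {μ : Measure ℂ} [SFinite μ] {p : ℝ} (hp : 1 ≤ p)
    {K : ℂ → ℂ → ℂ} (hK : Measurable (Function.uncurry K)) {C : ℝ≥0}
    (h : ∀ f : ℂ → ℂ, MemLp f (ENNReal.ofReal p) μ →
      ∫⁻ z, (∫⁻ w, ‖f w‖ₑ * ‖K z w‖ₑ ∂μ) ^ p ∂μ ≤ C * ∫⁻ w, ‖f w‖ₑ ^ p ∂μ) :
    IsBoundedOnLp μ (ENNReal.ofReal p) K := by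
  have hp0 : 0 < p := by linarith
  have hpr : (ENNReal.ofReal p).toReal = p := ENNReal.toReal_ofReal hp0.le
  have hpn0 : ENNReal.ofReal p ≠ 0 := by simpa using hp0
  refine ⟨C ^ (1 / p), fun f hf => ?_⟩
  have hfp : ∫⁻ w, ‖f w‖ₑ ^ p ∂μ < ∞ := by
    have := (eLpNorm_lt_top_iff_lintegral_rpow_enorm_lt_top hpn0 ENNReal.ofReal_ne_top).1 hf.2
    rwa [hpr] at this
  have hprod : AEStronglyMeasurable (fun x : ℂ × ℂ => f x.2 * K x.1 x.2) (μ.prod μ) :=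
    (hf.1.comp_quasiMeasurePreserving Measure.quasiMeasurePreserving_snd).mul
      hK.aestronglyMeasurable
  have hinner : AEMeasurable (fun z => ∫⁻ w, ‖f w‖ₑ * ‖K z w‖ₑ ∂μ) μ := by
    have := hprod.enorm.lintegral_prod_right'
    simpa only [enorm_mul] using this
  have hfin : ∀ᵐ z ∂μ, ∫⁻ w, ‖f w‖ₑ * ‖K z w‖ₑ ∂μ < ∞ := by
    filter_upwards [ae_lt_top' (hinner.pow_const p)
      ((h f hf).trans_lt (ENNReal.mul_lt_top ENNReal.coe_lt_top hfp)).ne] with z hz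
    exact (ENNReal.rpow_lt_top_iff_of_pos hp0).1 hz
  have hmeas : AEStronglyMeasurable (integralOp μ K f) μ := hprod.integral_prod_right'
  have hle : eLpNorm (integralOp μ K f) (ENNReal.ofReal p) μ ≤
      ((C ^ (1 / p) : ℝ≥0) : ℝ≥0∞) * eLpNorm f (ENNReal.ofReal p) μ := by
    rw [eLpNorm_eq_lintegral_rpow_enorm_toReal hpn0 ENNReal.ofReal_ne_top,
      eLpNorm_eq_lintegral_rpow_enorm_toReal hpn0 ENNReal.ofReal_ne_top, hpr,
      ENNReal.coe_rpow_of_nonneg _ (by positivity), ← ENNReal.mul_rpow_of_nonneg _ _ (by positivity)]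
    gcongr
    refine le_trans (lintegral_mono fun z => ?_) (h f hf)
    gcongr
    refine (enorm_integral_le_lintegral_enorm _).trans (le_of_eq ?_)
    simp only [enorm_mul]
  refine ⟨?_, ⟨hmeas, hle.trans_lt (ENNReal.mul_lt_top ENNReal.coe_lt_top hf.2)⟩, hle⟩
  filter_upwards [hfin] with z hz
  refine ⟨hf.1.mul (hK.of_uncurry_left).aestronglyMeasurable, ?_⟩
  simpa only [HasFiniteIntegral, enorm_mul] using hz

/-- Converse of the preceding criterion for a nonnegative kernel: boundedness is applied to |f|, for
which nothing cancels. -/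
theorem IsBoundedOnLp.lintegral_le {μ : Measure ℂ} {p : ℝ} (hp : 1 ≤ p)
    {K : ℂ → ℂ → ℂ} {k : ℂ → ℂ → ℝ} (hk : ∀ᵐ w ∂μ, ∀ z, 0 ≤ k z w)
    (hKk : ∀ z w, K z w = (k z w : ℂ)) (hb : IsBoundedOnLp μ (ENNReal.ofReal p) K) :
    ∃ C : ℝ≥0, ∀ f : ℂ → ℂ, MemLp f (ENNReal.ofReal p) μ →
      ∫⁻ z, (∫⁻ w, ‖f w‖ₑ * ENNReal.ofReal (k z w) ∂μ) ^ p ∂μ ≤ C * ∫⁻ w, ‖f w‖ₑ ^ p ∂μ := by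
  have hp0 : 0 < p := by linarith
  have hpr : (ENNReal.ofReal p).toReal = p := ENNReal.toReal_ofReal hp0.le
  have hpn0 : ENNReal.ofReal p ≠ 0 := by simpa using hp0
  obtain ⟨C, hC⟩ := hb
  refine ⟨C ^ p, fun f hf => ?_⟩
  have hf' : MemLp (fun w => ((‖f w‖ : ℝ) : ℂ)) (ENNReal.ofReal p) μ := hf.norm.ofReal
  obtain ⟨h1, -, h3⟩ := hC _ hf'
  rw [eLpNorm_eq_lintegral_rpow_enorm_toReal hpn0 ENNReal.ofReal_ne_top,
      eLpNorm_eq_lintegral_rpow_enorm_toReal hpn0 ENNReal.ofReal_ne_top, hpr] at h3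
  have h4 := ENNReal.rpow_le_rpow h3 hp0.le
  rw [ENNReal.mul_rpow_of_nonneg _ _ hp0.le, ← ENNReal.rpow_mul, ← ENNReal.rpow_mul,
    one_div_mul_cancel hp0.ne', ENNReal.rpow_one, ENNReal.rpow_one] at h4
  rw [ENNReal.coe_rpow_of_nonneg _ hp0.le]
  refine le_trans (le_of_eq ?_) (h4.trans (le_of_eq ?_))
  · refine lintegral_congr_ae ?_
    -- Absolute convergence is essential here: a divergent Bochner integral would be 0 by
    -- convention.
    filter_upwards [h1] with z hz
    congr 1
    have hz' : Integrable (fun w => ‖f w‖ * k z w) μ := by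
      have := hz.re
      simpa [hKk, ← Complex.ofReal_mul] using this
    have hnn : 0 ≤ᵐ[μ] fun w => ‖f w‖ * k z w := by
      filter_upwards [hk] with w hw using mul_nonneg (norm_nonneg _) (hw z)
    have : integralOp μ K (fun w => ((‖f w‖ : ℝ) : ℂ)) z = ((∫ w, ‖f w‖ * k z w ∂μ : ℝ) : ℂ) := by
      rw [integralOp, ← integral_complex_ofReal]
      simp [hKk]
    rw [this, ← ofReal_norm, Complex.norm_real,
      Real.norm_of_nonneg (integral_nonneg_of_ae hnn), ofReal_integral_eq_lintegral_ofReal hz' hnn]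
    refine lintegral_congr fun w => ?_
    rw [ENNReal.ofReal_mul (norm_nonneg _), ofReal_norm]
  · congr 1
    refine lintegral_congr fun w => ?_
    rw [← ofReal_norm, ← ofReal_norm]
    simp

/-- Schur's test. -/
theorem schur_test {μ : Measure ℂ} [SFinite μ] {p q : ℝ} (hpq : p.HolderConjugate q)
    {k : ℂ → ℂ → ℝ≥0∞} (hk : Measurable (Function.uncurry k)) {h : ℂ → ℝ≥0∞} (hm : Measurable h)
    (h0 : ∀ᵐ w ∂μ, h w ≠ 0) (htop : ∀ᵐ w ∂μ, h w ≠ ∞) {A B : ℝ≥0∞}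
    (hA : ∀ᵐ z ∂μ, ∫⁻ w, k z w * h w ^ q ∂μ ≤ A * h z ^ q)
    (hB : ∀ᵐ w ∂μ, ∫⁻ z, k z w * h z ^ p ∂μ ≤ B * h w ^ p)
    {f : ℂ → ℝ≥0∞} (hf : AEMeasurable f μ) :
    ∫⁻ z, (∫⁻ w, f w * k z w ∂μ) ^ p ∂μ ≤ A ^ (p / q) * B * ∫⁻ w, f w ^ p ∂μ := by
  have hp := hpq.pos
  have hq := hpq.symm.pos
  have hk1 : ∀ z, Measurable (k z) := fun z => hk.of_uncurry_left
  have hk2 : ∀ w, Measurable fun z => k z w := fun w => hk.of_uncurry_right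
  have step : ∀ᵐ z ∂μ, (∫⁻ w, f w * k z w ∂μ) ^ p ≤
      A ^ (p / q) * ∫⁻ w, h z ^ p * (f w ^ p * k z w * (h w ^ p)⁻¹) ∂μ := by
    filter_upwards [hA] with z hz
    -- Splitting f k = (f k^{1/p} h⁻¹)(k^{1/q} h) prepares Hölder; `hA` then controls the second
    -- factor, and after Tonelli `hB` controls the first.
    have e : ∫⁻ w, f w * k z w ∂μ =
        ∫⁻ w, ((fun w => f w * k z w ^ (1 / p) * (h w)⁻¹) *
          fun w => k z w ^ (1 / q) * h w) w ∂μ := by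
      refine lintegral_congr_ae ?_
      filter_upwards [h0, htop] with w hw0 hwt
      have : k z w = k z w ^ (1 / p) * k z w ^ (1 / q) := by
        rw [← ENNReal.rpow_add_of_nonneg _ _ (by positivity) (by positivity)]
        rw [one_div, one_div, hpq.inv_add_inv_eq_one, ENNReal.rpow_one]
      calc f w * k z w = f w * (k z w ^ (1 / p) * k z w ^ (1 / q)) * ((h w)⁻¹ * h w) := by
            rw [← this, ENNReal.inv_mul_cancel hw0 hwt, mul_one]
        _ = _ := by simp only [Pi.mul_apply]; ring
    rw [e]
    have H := ENNReal.lintegral_mul_le_Lp_mul_Lq μ hpq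
      (f := fun w => f w * k z w ^ (1 / p) * (h w)⁻¹) (g := fun w => k z w ^ (1 / q) * h w)
      ((hf.mul ((hk1 z).pow_const _).aemeasurable).mul hm.inv.aemeasurable)
      (((hk1 z).pow_const _).mul hm).aemeasurable
    refine (ENNReal.rpow_le_rpow H hp.le).trans ?_
    rw [ENNReal.mul_rpow_of_nonneg _ _ hp.le, ← ENNReal.rpow_mul, ← ENNReal.rpow_mul,
      one_div_mul_cancel hp.ne', ENNReal.rpow_one]
    have e2 : ∀ w, (k z w ^ (1 / q) * h w) ^ q = k z w * h w ^ q := fun w => by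
      rw [ENNReal.mul_rpow_of_nonneg _ _ hq.le, ← ENNReal.rpow_mul, one_div_mul_cancel hq.ne',
        ENNReal.rpow_one]
    have e3 : ∀ w, (f w * k z w ^ (1 / p) * (h w)⁻¹) ^ p = f w ^ p * k z w * (h w ^ p)⁻¹ :=
      fun w => by
      rw [ENNReal.mul_rpow_of_nonneg _ _ hp.le, ENNReal.mul_rpow_of_nonneg _ _ hp.le,
        ← ENNReal.rpow_mul, one_div_mul_cancel hp.ne', ENNReal.rpow_one, ENNReal.inv_rpow]
    simp only [e2, e3]
    have e4 : (∫⁻ w, k z w * h w ^ q ∂μ) ^ (1 / q * p) ≤ A ^ (p / q) * h z ^ p := by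
      refine (ENNReal.rpow_le_rpow hz (by positivity)).trans (le_of_eq ?_)
      rw [ENNReal.mul_rpow_of_nonneg _ _ (by positivity), ← ENNReal.rpow_mul]
      congr 2 <;> field_simp
    calc _ ≤ (∫⁻ w, f w ^ p * k z w * (h w ^ p)⁻¹ ∂μ) * (A ^ (p / q) * h z ^ p) := by gcongr
      _ = A ^ (p / q) * (h z ^ p * ∫⁻ w, f w ^ p * k z w * (h w ^ p)⁻¹ ∂μ) := by ring
      _ = _ := by
        rw [lintegral_const_mul'']
        exact ((hf.pow_const p).mul (hk1 z).aemeasurable).mul (hm.pow_const p).inv.aemeasurable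
  have hprod : AEMeasurable (Function.uncurry fun z w =>
      h z ^ p * (f w ^ p * k z w * (h w ^ p)⁻¹)) (μ.prod μ) := by
    refine ((hm.comp measurable_fst).pow_const p).aemeasurable.mul ((AEMeasurable.mul ?_
      hk.aemeasurable).mul ((hm.comp measurable_snd).pow_const p).inv.aemeasurable)
    exact (hf.comp_quasiMeasurePreserving Measure.quasiMeasurePreserving_snd).pow_const p
  have hin : AEMeasurable (fun z => ∫⁻ w, h z ^ p * (f w ^ p * k z w * (h w ^ p)⁻¹) ∂μ) μ :=
    hprod.lintegral_prod_right'
  calc _ ≤ ∫⁻ z, A ^ (p / q) * ∫⁻ w, h z ^ p * (f w ^ p * k z w * (h w ^ p)⁻¹) ∂μ ∂μ :=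
        lintegral_mono_ae step
    _ = A ^ (p / q) * ∫⁻ w, ∫⁻ z, h z ^ p * (f w ^ p * k z w * (h w ^ p)⁻¹) ∂μ ∂μ := by
        rw [lintegral_const_mul'' _ hin, lintegral_lintegral_swap hprod]
    _ ≤ A ^ (p / q) * ∫⁻ w, B * f w ^ p ∂μ := by
        refine mul_le_mul' le_rfl (lintegral_mono_ae ?_)
        filter_upwards [hB, h0, htop] with w hw hw0 hwt
        have : ∀ z, h z ^ p * (f w ^ p * k z w * (h w ^ p)⁻¹) =
            f w ^ p * (h w ^ p)⁻¹ * (k z w * h z ^ p) := fun z => by ring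
        simp only [this]
        have hme : Measurable fun z => k z w * h z ^ p := (hk2 w).mul (hm.pow_const p)
        rw [lintegral_const_mul _ hme]
        calc _ ≤ f w ^ p * (h w ^ p)⁻¹ * (B * h w ^ p) := by gcongr
          _ = B * f w ^ p * ((h w ^ p)⁻¹ * h w ^ p) := by ring
          _ = _ := by
            rw [ENNReal.inv_mul_cancel, mul_one]
            · simp [hw0, hwt, hp.not_gt]
            · exact ENNReal.rpow_ne_top_of_nonneg hp.le hwt
    _ = _ := by rw [lintegral_const_mul'' _ (hf.pow_const p)]; ring

theorem measurable_ofReal_absKernel (α a b : ℝ) (m : ℕ) :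
    Measurable (Function.uncurry fun z w => ENNReal.ofReal (absKernel α a b m z w)) := by
  unfold absKernel Function.uncurry
  fun_prop

/-! ### Sufficiency of the conditions. -/

theorem isBoundedOnLp_kernelT_of_kernelS {α a b : ℝ} (ha : -1 < a) (hb : -1 < b) {m : ℕ} {p : ℝ}
    (hp : 1 ≤ p)
    (h : IsBoundedOnLp (diskMeasure a b) (ENNReal.ofReal p) (kernelS α a b m)) :
    IsBoundedOnLp (diskMeasure a b) (ENNReal.ofReal p) (kernelT α a b m) := by
  have := isFiniteMeasure_diskMeasure ha hb
  obtain ⟨C, hC⟩ := h.lintegral_le hp (k := absKernel α a b m)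
    ((ae_diskMeasure a b).mono fun w hw z => absKernel_nonneg α a b m z hw.1)
    (fun z w => kernelS_eq α a b m z w)
  refine isBoundedOnLp_of_lintegral_le hp (measurable_kernelT α a b m) (C := C) fun f hf => ?_
  refine le_trans (le_of_eq ?_) (hC f hf)
  refine lintegral_congr fun z => ?_
  congr 1
  refine lintegral_congr_ae ?_
  filter_upwards [ae_diskMeasure a b] with w hw
  rw [← ofReal_norm (kernelT α a b m z w), norm_kernelT hw.1 hw.2]

theorem isBoundedOnLp_kernelS_of_lintegral_le {α a b : ℝ} (ha : -1 < a) (hb : -1 < b) {m : ℕ}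
    {p : ℝ} (hp : 1 ≤ p) {C : ℝ≥0∞} (hCtop : C ≠ ∞)
    (h : ∀ f : ℂ → ℝ≥0∞, AEMeasurable f (diskMeasure a b) →
      ∫⁻ z, (∫⁻ w, f w * ENNReal.ofReal (absKernel α a b m z w) ∂diskMeasure a b) ^ p
        ∂diskMeasure a b ≤ C * ∫⁻ w, f w ^ p ∂diskMeasure a b) :
    IsBoundedOnLp (diskMeasure a b) (ENNReal.ofReal p) (kernelS α a b m) := by
  have := isFiniteMeasure_diskMeasure ha hb
  lift C to ℝ≥0 using hCtop
  refine isBoundedOnLp_of_lintegral_le hp (measurable_kernelS α a b m) (C := C) fun f hf => ?_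
  refine le_trans (le_of_eq ?_) (h (fun w => ‖f w‖ₑ) hf.1.enorm)
  refine lintegral_congr fun z => ?_
  congr 1
  refine lintegral_congr_ae ?_
  filter_upwards [ae_diskMeasure a b] with w hw
  rw [← ofReal_norm (kernelS α a b m z w), kernelS_eq, Complex.norm_real,
    Real.norm_of_nonneg (absKernel_nonneg α a b m z hw.1)]

theorem norm_one_sub_mul_conj_comm (z w : ℂ) :
    ‖1 - z * starRingEnd ℂ w‖ = ‖1 - w * starRingEnd ℂ z‖ := by
  rw [← Complex.norm_conj]
  simp [mul_comm]

/-- One half of Schur's test. Forelli–Rudin with t = -Y yields |z|^{-m}(1-|z|²)^Y, and |z|^{-m} ≤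
|z|^X because |z| < 1 and X ≤ -m. The lower bounds on X and Y are integrability at 0 and at the
circle. -/
theorem exists_lintegral_absKernel_le_left {α a b : ℝ} (ha : -1 < a) (hb : -1 < b) (m : ℕ)
    {X Y : ℝ} (hX : -2 < m + X) (hX' : X ≤ -m) (hY : -1 < α + Y) (hY' : Y < 0) :
    ∃ C : ℝ, 0 < C ∧ ∀ᵐ z ∂diskMeasure a b,
      ∫⁻ w, ENNReal.ofReal (absKernel α a b m z w) *
        ENNReal.ofReal (‖w‖ ^ X * (1 - ‖w‖ ^ 2) ^ Y) ∂diskMeasure a b ≤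
      ENNReal.ofReal C * ENNReal.ofReal (‖z‖ ^ X * (1 - ‖z‖ ^ 2) ^ Y) := by
  obtain ⟨C, hC, h⟩ := diskMeasure_forelli_rudin ha hb (X := m - 2 * b + X) (Y := α - a + Y)
    (t := -Y) (e := 2 + α) (by linarith) (by linarith) (by linarith) (by ring)
  refine ⟨C, hC, ?_⟩
  filter_upwards [ae_diskMeasure a b] with z hz
  have hz0 : 0 < ‖z‖ := norm_pos_iff.2 hz.2
  have hz1 : 0 < 1 - ‖z‖ ^ 2 := by nlinarith [hz.1]
  calc _ = ∫⁻ w, ENNReal.ofReal (‖z‖ ^ (-(m : ℝ))) * ENNReal.ofReal (‖w‖ ^ (m - 2 * b + X) *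
        (1 - ‖w‖ ^ 2) ^ (α - a + Y) * ‖1 - w * starRingEnd ℂ z‖ ^ (-(2 + α))) ∂diskMeasure a b := by
        refine lintegral_congr_ae ?_
        filter_upwards [ae_diskMeasure a b] with w hw
        have hw0 : 0 < ‖w‖ := norm_pos_iff.2 hw.2
        have hw1 : 0 < 1 - ‖w‖ ^ 2 := by nlinarith [hw.1]
        rw [← ENNReal.ofReal_mul (absKernel_nonneg α a b m z hw.1),
          ← ENNReal.ofReal_mul (by positivity), absKernel, Real.rpow_add hw0, Real.rpow_add hw1,
          norm_one_sub_mul_conj_comm z w]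
        congr 1; ring
    _ ≤ ENNReal.ofReal (‖z‖ ^ (-(m : ℝ))) * ENNReal.ofReal (C * (1 - ‖z‖ ^ 2) ^ (- -Y)) := by
        rw [lintegral_const_mul _ (by fun_prop)]
        gcongr
        exact h z hz.1
    _ ≤ _ := by
        rw [neg_neg, ← ENNReal.ofReal_mul (by positivity), ← ENNReal.ofReal_mul hC.le]
        apply ENNReal.ofReal_le_ofReal
        have := Real.rpow_le_rpow_of_exponent_ge hz0 hz.1.le hX'
        calc _ ≤ ‖z‖ ^ X * (C * (1 - ‖z‖ ^ 2) ^ Y) := by gcongr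
          _ = _ := by ring

/-- The other half, with t = α - a - Y: the factor |w|^{m-2b} is absorbed since X ≤ m - 2b. Equality
is allowed there, so X = Y = 0 covers p = 1 including 2b = m. -/
theorem exists_lintegral_absKernel_le_right {α a b : ℝ} (ha : -1 < a) (hb : -1 < b) (m : ℕ)
    {X Y : ℝ} (hX : -2 < 2 * b - m + X) (hX' : X ≤ m - 2 * b) (hY : -1 < a + Y) (hY' : Y < α - a) :
    ∃ C : ℝ, 0 < C ∧ ∀ᵐ w ∂diskMeasure a b,
      ∫⁻ z, ENNReal.ofReal (absKernel α a b m z w) *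
        ENNReal.ofReal (‖z‖ ^ X * (1 - ‖z‖ ^ 2) ^ Y) ∂diskMeasure a b ≤
      ENNReal.ofReal C * ENNReal.ofReal (‖w‖ ^ X * (1 - ‖w‖ ^ 2) ^ Y) := by
  obtain ⟨C, hC, h⟩ := diskMeasure_forelli_rudin ha hb (X := -m + X) (Y := Y)
    (t := α - a - Y) (e := 2 + α) (by linarith) (by linarith) (by linarith) (by ring)
  refine ⟨C, hC, ?_⟩
  filter_upwards [ae_diskMeasure a b] with w hw
  have hw0 : 0 < ‖w‖ := norm_pos_iff.2 hw.2
  have hw1 : 0 < 1 - ‖w‖ ^ 2 := by nlinarith [hw.1]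
  calc _ = ∫⁻ z, ENNReal.ofReal ((1 - ‖w‖ ^ 2) ^ (α - a) * ‖w‖ ^ ((m : ℝ) - 2 * b)) *
        ENNReal.ofReal (‖z‖ ^ (-m + X) * (1 - ‖z‖ ^ 2) ^ Y *
          ‖1 - z * starRingEnd ℂ w‖ ^ (-(2 + α))) ∂diskMeasure a b := by
        refine lintegral_congr_ae ?_
        filter_upwards [ae_diskMeasure a b] with z hz
        have hz0 : 0 < ‖z‖ := norm_pos_iff.2 hz.2
        rw [← ENNReal.ofReal_mul (absKernel_nonneg α a b m z hw.1),
          ← ENNReal.ofReal_mul (by positivity), absKernel, Real.rpow_add hz0]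
        congr 1; ring
    _ ≤ ENNReal.ofReal ((1 - ‖w‖ ^ 2) ^ (α - a) * ‖w‖ ^ ((m : ℝ) - 2 * b)) *
          ENNReal.ofReal (C * (1 - ‖w‖ ^ 2) ^ (-(α - a - Y))) := by
        rw [lintegral_const_mul _ (by fun_prop)]
        gcongr
        exact h w hw.1
    _ ≤ _ := by
        rw [← ENNReal.ofReal_mul (by positivity), ← ENNReal.ofReal_mul hC.le]
        apply ENNReal.ofReal_le_ofReal
        have h1 := Real.rpow_le_rpow_of_exponent_ge hw0 hw.1.le hX'
        have h2 : (1 - ‖w‖ ^ 2) ^ Y = (1 - ‖w‖ ^ 2) ^ (α - a) * (1 - ‖w‖ ^ 2) ^ (-(α - a - Y)) := by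
          rw [← Real.rpow_add hw1]; ring_nf
        calc _ = ‖w‖ ^ ((m : ℝ) - 2 * b) * (C * (1 - ‖w‖ ^ 2) ^ Y) := by rw [h2]; ring
          _ ≤ ‖w‖ ^ X * (C * (1 - ‖w‖ ^ 2) ^ Y) := by gcongr
          _ = _ := by ring

theorem isBoundedOnLp_kernelS_one {α a b : ℝ} (ha : -1 < a) (hb : -1 < b) {m : ℕ} (h1 : a < α)
    (h2 : (m : ℝ) - 2 < 2 * b) (h3 : 2 * b ≤ m) :
    IsBoundedOnLp (diskMeasure a b) (ENNReal.ofReal 1) (kernelS α a b m) := by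
  have := isFiniteMeasure_diskMeasure ha hb
  obtain ⟨C, -, h⟩ := exists_lintegral_absKernel_le_right (α := α) ha hb m (X := 0) (Y := 0)
    (by linarith) (by linarith) (by linarith) (by linarith)
  refine isBoundedOnLp_kernelS_of_lintegral_le ha hb le_rfl (C := ENNReal.ofReal C)
    ENNReal.ofReal_ne_top fun f hf => ?_
  simp only [ENNReal.rpow_one]
  have hk := measurable_ofReal_absKernel α a b m
  have hprod : AEMeasurable (Function.uncurry fun z w =>
      f w * ENNReal.ofReal (absKernel α a b m z w)) ((diskMeasure a b).prod (diskMeasure a b)) :=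
    (hf.comp_quasiMeasurePreserving Measure.quasiMeasurePreserving_snd).mul hk.aemeasurable
  rw [lintegral_lintegral_swap hprod, ← lintegral_const_mul'' _ hf]
  refine lintegral_mono_ae ?_
  filter_upwards [h] with w hw
  have hkw : Measurable fun z => ENNReal.ofReal (absKernel α a b m z w) :=
    hk.of_uncurry_right
  rw [lintegral_const_mul _ hkw, mul_comm]
  gcongr
  simpa using hw

theorem exists_between_max_min {u v x y : ℝ} (h1 : u < v) (h2 : u < y) (h3 : x < v) (h4 : x < y) :
    ∃ t, u < t ∧ x < t ∧ t < v ∧ t < y := by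
  obtain ⟨t, ht1, ht2⟩ := exists_between (max_lt (lt_min h1 h2) (lt_min h3 h4))
  exact ⟨t, (le_max_left _ _).trans_lt ht1, (le_max_right _ _).trans_lt ht1,
    ht2.trans_le (min_le_left _ _), ht2.trans_le (min_le_right _ _)⟩

theorem isBoundedOnLp_kernelS_of_one_lt {α a b : ℝ} (hα : -1 < α) (ha : -1 < a) (hb : -1 < b)
    {m : ℕ} {p : ℝ} (hp : 1 < p) (h1 : a + 1 < p * (α + 1)) (h2 : m * p - 2 < 2 * b)
    (h3 : 2 * b < m * p - 2 + 2 * p) :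
    IsBoundedOnLp (diskMeasure a b) (ENNReal.ofReal p) (kernelS α a b m) := by
  have := isFiniteMeasure_diskMeasure ha hb
  have hpq := Real.HolderConjugate.conjExponent hp
  set q := p.conjExponent with hq
  have hp0 : 0 < p := by linarith
  have hq0 : 0 < q := hpq.symm.pos
  have hpq' : p = q * (p - 1) := by
    rw [hq, Real.conjExponent, div_mul_cancel₀ _ (by linarith)]
  have hp1 : 0 < p - 1 := by linarith
  have hqp : q⁻¹ = (p - 1) / p := by
    rw [eq_div_iff hp0.ne']; nth_rewrite 1 [hpq']; field_simp
  -- The exponent x q must suit the left estimate and x p the right one. Of the four compatibility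
  -- inequalities, the two mixed ones are 2b < mp - 2 + 2p and mp - 2 < 2b.
  obtain ⟨x, hx1, hx2, hx3, hx4⟩ := exists_between_max_min
    (u := -(m + 2) * q⁻¹) (x := (m - 2 - 2 * b) / p) (v := -m * q⁻¹) (y := (m - 2 * b) / p)
    (by rw [hqp, neg_mul, neg_mul, neg_lt_neg_iff]; gcongr; linarith)
    (by rw [hqp, ← mul_div_assoc]; gcongr; nlinarith)
    (by rw [hqp, ← mul_div_assoc]; gcongr; nlinarith)
    (by gcongr; linarith)
  -- Likewise for y; the inequality -(1+α)/q < (α-a)/p is a + 1 < p(α+1).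
  obtain ⟨y, hy1, hy2, hy3, hy4⟩ := exists_between_max_min
    (u := -(1 + α) * q⁻¹) (x := (-1 - a) / p) (v := 0) (y := (α - a) / p)
    (by have : 0 < q⁻¹ := by positivity
        nlinarith)
    (by rw [hqp, ← mul_div_assoc]; gcongr; nlinarith)
    (div_neg_of_neg_of_pos (by linarith) hp0)
    (by gcongr)
  rw [← div_eq_mul_inv, div_lt_iff₀ hq0] at hx1 hy1
  rw [← div_eq_mul_inv, lt_div_iff₀ hq0] at hx3
  rw [div_lt_iff₀ hp0] at hx2 hy2
  rw [lt_div_iff₀ hp0] at hx4 hy4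
  obtain ⟨A, -, hA⟩ := exists_lintegral_absKernel_le_left (α := α) ha hb m (X := x * q) (Y := y * q)
    (by linarith) (by linarith) (by linarith) (by nlinarith)
  obtain ⟨B, -, hB⟩ := exists_lintegral_absKernel_le_right (α := α) ha hb m (X := x * p) (Y := y * p)
    (by linarith) (by linarith) (by linarith) (by linarith)
  set h : ℂ → ℝ≥0∞ := fun w => ENNReal.ofReal (‖w‖ ^ x * (1 - ‖w‖ ^ 2) ^ y) with hh
  have hpow : ∀ s : ℝ, 0 < s → ∀ w : ℂ, ‖w‖ < 1 →
      h w ^ s = ENNReal.ofReal (‖w‖ ^ (x * s) * (1 - ‖w‖ ^ 2) ^ (y * s)) := by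
    intro s hs w hw
    have hw1 : 0 < 1 - ‖w‖ ^ 2 := by nlinarith [norm_nonneg w]
    rw [hh, ENNReal.ofReal_rpow_of_nonneg (by positivity) hs.le,
      Real.mul_rpow (by positivity) (by positivity), Real.rpow_mul (norm_nonneg _),
      Real.rpow_mul hw1.le]
  refine isBoundedOnLp_kernelS_of_lintegral_le ha hb hp.le
    (C := ENNReal.ofReal A ^ (p / q) * ENNReal.ofReal B) ?_ fun f hf => ?_
  · exact ENNReal.mul_ne_top (ENNReal.rpow_ne_top_of_nonneg (by positivity) ENNReal.ofReal_ne_top)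
      ENNReal.ofReal_ne_top
  · refine schur_test hpq (measurable_ofReal_absKernel α a b m) (h := h)
      (by fun_prop) ?_ ?_ ?_ ?_ hf
    · filter_upwards [ae_diskMeasure a b] with w hw
      have hw0 : 0 < ‖w‖ := norm_pos_iff.2 hw.2
      have hw1 : 0 < 1 - ‖w‖ ^ 2 := by nlinarith [hw.1]
      have : 0 < ‖w‖ ^ x * (1 - ‖w‖ ^ 2) ^ y := by positivity
      simpa [hh] using this
    · exact Filter.Eventually.of_forall fun w => ENNReal.ofReal_ne_top
    · filter_upwards [hA, ae_diskMeasure a b] with z hz hz'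
      rw [hpow q hq0 z hz'.1]
      refine le_trans (le_of_eq (lintegral_congr_ae ?_)) hz
      filter_upwards [ae_diskMeasure a b] with w hw
      rw [hpow q hq0 w hw.1]
    · filter_upwards [hB, ae_diskMeasure a b] with w hw hw'
      rw [hpow p hp0 w hw'.1]
      refine le_trans (le_of_eq (lintegral_congr_ae ?_)) hw
      filter_upwards [ae_diskMeasure a b] with z hz
      rw [hpow p hp0 z hz.1]

/-! ### Necessity: test functions seen from the origin. -/

theorem restrict_absolutelyContinuous_diskMeasure {a b : ℝ} (ha : -1 < a) (hb : -1 < b) :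
    (volume : Measure ℂ).restrict unitDisc ≪ diskMeasure a b := by
  have hB := ProbabilityTheory.beta_pos (α := a + 1) (β := b + 1) (by linarith) (by linarith)
  have h1 : (volume : Measure ℂ).restrict unitDisc ≪ areaMeasure :=
    Measure.absolutelyContinuous_smul (by simp [Real.pi_pos])
  refine h1.trans (withDensity_absolutelyContinuous' (by fun_prop) ?_)
  have h2 : areaMeasure ≪ (volume : Measure ℂ).restrict unitDisc :=
    Measure.smul_absolutelyContinuous
  refine h2.ae_le ?_
  filter_upwards [ae_restrict_mem measurableSet_unitDisc,
    ae_restrict_of_ae (Measure.ae_ne volume (0 : ℂ))] with z hz hz0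
  have hz1 := mem_unitDisc.1 hz
  have h3 : 0 < 1 - ‖z‖ ^ 2 := by nlinarith [norm_nonneg z]
  have h4 : 0 < ‖z‖ := norm_pos_iff.2 hz0
  have : 0 < 1 / ProbabilityTheory.beta (a + 1) (b + 1) * ‖z‖ ^ (2 * b) * (1 - ‖z‖ ^ 2) ^ a := by
    positivity
  simpa using this

theorem diskMeasure_ball_ne_zero {a b : ℝ} (ha : -1 < a) (hb : -1 < b) {w : ℂ} (hw : ‖w‖ < 1)
    {r : ℝ} (hr : 0 < r) : diskMeasure a b (Metric.ball w r) ≠ 0 := by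
  intro h
  have := restrict_absolutelyContinuous_diskMeasure ha hb h
  rw [Measure.restrict_apply measurableSet_ball] at this
  exact ((Metric.isOpen_ball.inter Metric.isOpen_ball).measure_pos volume
    ⟨w, Metric.mem_ball_self hr, mem_unitDisc.2 hw⟩).ne' this

/-- The modulus of the kernels at `z` close to the origin, up to the factor `|z|^{-m}`. -/
noncomputable def radialKernel (α a b : ℝ) (m : ℕ) (w : ℂ) : ℝ :=
  (1 - ‖w‖ ^ 2) ^ (α - a) * ‖w‖ ^ ((m : ℝ) - 2 * b)

theorem radialKernel_pos {α a b : ℝ} {m : ℕ} {w : ℂ} (hw : ‖w‖ < 1) (hw0 : w ≠ 0) :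
    0 < radialKernel α a b m w := by
  have h3 : 0 < 1 - ‖w‖ ^ 2 := by nlinarith [norm_nonneg w]
  have h4 : 0 < ‖w‖ := norm_pos_iff.2 hw0
  unfold radialKernel
  positivity

theorem measurable_radialKernel (α a b : ℝ) (m : ℕ) : Measurable (radialKernel α a b m) := by
  unfold radialKernel
  fun_prop

theorem exists_half_le_re_one_sub_cpow (s : ℂ) :
    ∃ ε : ℝ, 0 < ε ∧ ε < 1 ∧ ∀ u : ℂ, ‖u‖ < ε → 1 / 2 ≤ (1 / (1 - u) ^ s).re := by
  have hc : ContinuousAt (fun u : ℂ => (1 / (1 - u) ^ s).re) 0 := by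
    refine Complex.continuous_re.continuousAt.comp (ContinuousAt.div continuousAt_const ?_ (by simp))
    exact ContinuousAt.cpow (by fun_prop) continuousAt_const (by simp)
  have h := hc.eventually (lt_mem_nhds (a := (1 / 2 : ℝ)) (by norm_num))
  obtain ⟨ε, hε, h⟩ := Metric.eventually_nhds_iff.1 h
  refine ⟨min ε (1 / 2), by positivity, (min_le_right _ _).trans_lt (by norm_num), fun u hu => ?_⟩
  exact (h (by simpa using hu.trans_le (min_le_left _ _))).le

/-- The unimodular factor cancels the argument of w^m, so the only non-positive factors left are
1/z^m, constant in w, and a power close to 1 for small z. -/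
theorem mul_kernelT_conj_phase {α a b : ℝ} {m : ℕ} {z w : ℂ} (hw0 : w ≠ 0) (h : ℝ) :
    (h : ℂ) * (starRingEnd ℂ w / ‖w‖) ^ m * kernelT α a b m z w =
      1 / z ^ m * (((h * radialKernel α a b m w : ℝ) : ℂ) *
        (1 / (1 - z * starRingEnd ℂ w) ^ ((2 + α : ℝ) : ℂ))) := by
  have h4 : 0 < ‖w‖ := norm_pos_iff.2 hw0
  have e : (starRingEnd ℂ w / ‖w‖) ^ m * w ^ m = ((‖w‖ ^ m : ℝ) : ℂ) := by
    rw [← mul_pow, div_mul_eq_mul_div, mul_comm, Complex.mul_conj, Complex.normSq_eq_norm_sq,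
      Complex.ofReal_pow]
    have e0 : ((‖w‖ : ℂ) ^ 2 / ‖w‖) = ‖w‖ := by
      have : (‖w‖ : ℂ) ≠ 0 := by simpa using hw0
      field_simp
    rw [e0]; push_cast; rfl
  unfold kernelT radialKernel
  rw [Real.rpow_sub h4, Real.rpow_natCast]
  calc _ = 1 / z ^ m * ((h : ℂ) * (((1 - ‖w‖ ^ 2) ^ (α - a) : ℝ) : ℂ) *
        ((starRingEnd ℂ w / ‖w‖) ^ m * w ^ m) / (((‖w‖ ^ (2 * b) : ℝ) : ℂ) *
          (1 - z * starRingEnd ℂ w) ^ ((2 + α : ℝ) : ℂ))) := by ring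
    _ = _ := by rw [e]; push_cast; ring

/-- The modulus of the integral dominates its real part, which is ∫ G Re E. -/
theorem lintegral_le_enorm_integral_of_re {μ : Measure ℂ} {G : ℂ → ℝ} {E : ℂ → ℂ}
    (hG : 0 ≤ᵐ[μ] G) (hE : ∀ᵐ w ∂μ, 1 / 2 ≤ (E w).re) (hi : Integrable (fun w => (G w : ℂ) * E w) μ) :
    2⁻¹ * ∫⁻ w, ENNReal.ofReal (G w) ∂μ ≤ ‖∫ w, (G w : ℂ) * E w ∂μ‖ₑ := by
  have hre : ∀ w, ((G w : ℂ) * E w).re = G w * (E w).re := fun w => by simp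
  have hir := hi.re
  simp only [RCLike.re_to_complex, hre] at hir
  calc _ = ∫⁻ w, 2⁻¹ * ENNReal.ofReal (G w) ∂μ := by rw [lintegral_const_mul' _ _ (by simp)]
    _ ≤ ∫⁻ w, ENNReal.ofReal (G w * (E w).re) ∂μ := by
        refine lintegral_mono_ae ?_
        filter_upwards [hG, hE] with w h1 h2
        rw [ENNReal.ofReal_mul h1, mul_comm]
        gcongr
        rw [show (2⁻¹ : ℝ≥0∞) = ENNReal.ofReal (1 / 2) by
          rw [one_div, ENNReal.ofReal_inv_of_pos two_pos]; simp]
        exact ENNReal.ofReal_le_ofReal h2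
    _ = ENNReal.ofReal (∫ w, G w * (E w).re ∂μ) := by
        rw [ofReal_integral_eq_lintegral_ofReal hir]
        filter_upwards [hG, hE] with w h1 h2 using mul_nonneg h1 (by linarith)
    _ = ENNReal.ofReal (∫ w, (G w : ℂ) * E w ∂μ).re := by
        have := integral_re hi
        simp only [RCLike.re_to_complex, hre] at this
        rw [this]
    _ ≤ _ := by
        rw [← ofReal_norm]
        exact ENNReal.ofReal_le_ofReal (Complex.re_le_norm _)

/-- For |z| < ε the lower bound for |Tf(z)| is |z|^{-m} times a number independent of z, so its p-th
power integrates to a product. The bound N only serves to put f in L^p; C depends on neither h nor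
N. -/
theorem exists_test_bound_of_isBoundedOnLp {α a b : ℝ} (ha : -1 < a) (hb : -1 < b)
    {m : ℕ} {p : ℝ} (hp : 1 ≤ p)
    (hT : IsBoundedOnLp (diskMeasure a b) (ENNReal.ofReal p) (kernelT α a b m)) :
    ∃ ε : ℝ, 0 < ε ∧ ε < 1 ∧ ∃ C : ℝ≥0, ∀ (h : ℂ → ℝ) (N : ℝ), Measurable h →
      (∀ᵐ w ∂diskMeasure a b, 0 ≤ h w) → (∀ᵐ w ∂diskMeasure a b, h w ≤ N) →
      (∫⁻ z in Metric.ball 0 ε, ENNReal.ofReal (‖z‖ ^ (-(m * p))) ∂diskMeasure a b) *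
        (2⁻¹ * ∫⁻ w, ENNReal.ofReal (h w * radialKernel α a b m w) ∂diskMeasure a b) ^ p ≤
      C * ∫⁻ w, ENNReal.ofReal (h w ^ p) ∂diskMeasure a b := by
  have := isFiniteMeasure_diskMeasure ha hb
  have hp0 : 0 < p := by linarith
  have hpr : (ENNReal.ofReal p).toReal = p := ENNReal.toReal_ofReal hp0.le
  have hpn0 : ENNReal.ofReal p ≠ 0 := by simpa using hp0
  obtain ⟨ε, hε0, hε1, hε⟩ := exists_half_le_re_one_sub_cpow ((2 + α : ℝ) : ℂ)
  obtain ⟨C, hC⟩ := hT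
  refine ⟨ε, hε0, hε1, C ^ p, fun h N hm h0 hN => ?_⟩
  set f : ℂ → ℂ := fun w => (h w : ℂ) * (starRingEnd ℂ w / ‖w‖) ^ m with hf
  have hfm : Measurable f := by
    have : Measurable fun w => (h w : ℂ) := Complex.measurable_ofReal.comp hm
    exact this.mul (by fun_prop)
  have hfn : ∀ᵐ w ∂diskMeasure a b, ‖f w‖ = h w := by
    filter_upwards [ae_diskMeasure a b, h0] with w hw hw0
    have : ‖w‖ ≠ 0 := norm_ne_zero_iff.2 hw.2
    simp [hf, this, abs_of_nonneg hw0]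
  have hfL : MemLp f (ENNReal.ofReal p) (diskMeasure a b) := by
    refine MemLp.of_bound hfm.aestronglyMeasurable N ?_
    filter_upwards [hfn, hN] with w h1 h2
    rwa [h1]
  obtain ⟨h1, -, h3⟩ := hC f hfL
  rw [eLpNorm_eq_lintegral_rpow_enorm_toReal hpn0 ENNReal.ofReal_ne_top,
      eLpNorm_eq_lintegral_rpow_enorm_toReal hpn0 ENNReal.ofReal_ne_top, hpr] at h3
  have h4 := ENNReal.rpow_le_rpow h3 hp0.le
  rw [ENNReal.mul_rpow_of_nonneg _ _ hp0.le, ← ENNReal.rpow_mul, ← ENNReal.rpow_mul,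
    one_div_mul_cancel hp0.ne', ENNReal.rpow_one, ENNReal.rpow_one] at h4
  rw [ENNReal.coe_rpow_of_nonneg _ hp0.le]
  have e1 : ∫⁻ w, ENNReal.ofReal (h w ^ p) ∂diskMeasure a b = ∫⁻ w, ‖f w‖ₑ ^ p ∂diskMeasure a b := by
    refine lintegral_congr_ae ?_
    filter_upwards [hfn, h0] with w h1 h2
    rw [← ofReal_norm, h1, ENNReal.ofReal_rpow_of_nonneg h2 hp0.le]
  rw [e1]
  refine le_trans ?_ h4
  rw [← lintegral_mul_const _ (by fun_prop)]
  refine le_trans ?_ (setLIntegral_le_lintegral (Metric.ball 0 ε) _)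
  refine setLIntegral_mono_ae' measurableSet_ball ?_
  filter_upwards [h1, ae_diskMeasure a b] with z hz hzD hzε
  have hz0 : 0 < ‖z‖ := norm_pos_iff.2 hzD.2
  have hzm : (z ^ m) ≠ 0 := pow_ne_zero _ hzD.2
  have hE : ∀ᵐ w ∂diskMeasure a b,
      1 / 2 ≤ (1 / (1 - z * starRingEnd ℂ w) ^ ((2 + α : ℝ) : ℂ)).re := by
    filter_upwards [ae_diskMeasure a b] with w hw
    refine hε _ ?_
    rw [norm_mul, Complex.norm_conj]
    have : ‖z‖ < ε := by simpa using hzε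
    nlinarith [hw.1, norm_nonneg w]
  have hG : 0 ≤ᵐ[diskMeasure a b] fun w => h w * radialKernel α a b m w := by
    filter_upwards [ae_diskMeasure a b, h0] with w hw hw0
    exact mul_nonneg hw0 (radialKernel_pos hw.1 hw.2).le
  have hcongr : (fun w => f w * kernelT α a b m z w) =ᵐ[diskMeasure a b]
      fun w => 1 / z ^ m * (((h w * radialKernel α a b m w : ℝ) : ℂ) *
        (1 / (1 - z * starRingEnd ℂ w) ^ ((2 + α : ℝ) : ℂ))) := by
    filter_upwards [ae_diskMeasure a b] with w hw
    exact mul_kernelT_conj_phase hw.2 (h w)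
  have hi := (hz.congr hcongr).const_mul (z ^ m)
  have hcancel : ∀ x : ℂ, z ^ m * (1 / z ^ m * x) = x := fun x => by field_simp
  simp only [hcancel] at hi
  have key := lintegral_le_enorm_integral_of_re hG hE hi
  have hval : integralOp (diskMeasure a b) (kernelT α a b m) f z = 1 / z ^ m *
      ∫ w, ((h w * radialKernel α a b m w : ℝ) : ℂ) *
        (1 / (1 - z * starRingEnd ℂ w) ^ ((2 + α : ℝ) : ℂ)) ∂diskMeasure a b := by
    rw [integralOp, integral_congr_ae hcongr, integral_const_mul]
  rw [hval, enorm_mul, ENNReal.mul_rpow_of_nonneg ‖1 / z ^ m‖ₑ _ hp0.le]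
  refine mul_le_mul' ?_ (ENNReal.rpow_le_rpow key hp0.le)
  rw [← ofReal_norm, norm_div, norm_one, norm_pow, ENNReal.ofReal_rpow_of_nonneg (by positivity) hp0.le]
  apply le_of_eq
  congr 1
  rw [one_div, ← Real.rpow_natCast, ← Real.rpow_neg hz0.le, ← Real.rpow_mul hz0.le, neg_mul]

theorem exponents_of_lintegral_diskMeasure_lt_top {a b : ℝ} (ha : -1 < a) (hb : -1 < b) {X Y : ℝ}
    (h : ∫⁻ z, ENNReal.ofReal (‖z‖ ^ X * (1 - ‖z‖ ^ 2) ^ Y) ∂diskMeasure a b < ∞) :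
    -2 < 2 * b + X ∧ -1 < a + Y := by
  rw [lintegral_diskMeasure ha hb (by fun_prop)] at h
  have hκ := diskConst_pos ha hb
  apply exponents_of_lintegral_unitDisc_lt_top
  have h2 : ∫⁻ z in unitDisc, ENNReal.ofReal (‖z‖ ^ (2 * b) * (1 - ‖z‖ ^ 2) ^ a) *
      ENNReal.ofReal (‖z‖ ^ X * (1 - ‖z‖ ^ 2) ^ Y) < ∞ := by
    refine lt_of_le_of_ne le_top fun h' => ?_
    rw [h', ENNReal.mul_top (by simpa using hκ)] at h
    exact lt_irrefl _ h
  refine lt_of_eq_of_lt (lintegral_congr_ae ?_) h2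
  filter_upwards [ae_restrict_mem measurableSet_unitDisc,
    ae_restrict_of_ae (Measure.ae_ne volume (0 : ℂ))] with z h1 h2
  rw [mem_unitDisc] at h1
  have hz : 0 < ‖z‖ := norm_pos_iff.2 h2
  have hz1 : 0 < 1 - ‖z‖ ^ 2 := by nlinarith
  rw [← ENNReal.ofReal_mul (by positivity), Real.rpow_add hz, Real.rpow_add hz1]
  congr 1; ring

theorem lower_exponent_of_isBoundedOnLp_kernelT {α a b : ℝ} (ha : -1 < a)
    (hb : -1 < b) {m : ℕ} {p : ℝ} (hp : 1 ≤ p)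
    (hT : IsBoundedOnLp (diskMeasure a b) (ENNReal.ofReal p) (kernelT α a b m)) :
    m * p - 2 < 2 * b := by
  have := isFiniteMeasure_diskMeasure ha hb
  have hp0 : 0 < p := by linarith
  obtain ⟨ε, hε0, hε1, C, hC⟩ := exists_test_bound_of_isBoundedOnLp ha hb hp hT
  -- With h = 1 the second factor is nonzero and the right side finite, forcing |z|^{-mp} to be
  -- integrable near 0.
  have h := hC (fun _ => 1) 1 measurable_const (by simp) (by simp)
  simp only [one_mul, Real.one_rpow, ENNReal.ofReal_one, lintegral_one] at h
  have hX0 : ∫⁻ w, ENNReal.ofReal (radialKernel α a b m w) ∂diskMeasure a b ≠ 0 := by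
    intro h0
    rw [lintegral_eq_zero_iff (measurable_radialKernel α a b m).ennreal_ofReal] at h0
    have : ∀ᵐ w ∂diskMeasure a b, False := by
      filter_upwards [h0, ae_diskMeasure a b] with w h1 h2
      have := radialKernel_pos (α := α) (a := a) (b := b) (m := m) h2.1 h2.2
      simp only [Pi.zero_apply, ENNReal.ofReal_eq_zero] at h1
      linarith
    refine diskMeasure_ball_ne_zero ha hb (w := 0) (by simp) one_pos ?_
    rw [Filter.eventually_false_iff_eq_bot, ae_eq_bot] at this
    simp [this]
  have hM : ∫⁻ z in Metric.ball 0 ε, ENNReal.ofReal (‖z‖ ^ (-(m * p))) ∂diskMeasure a b ≠ ∞ := by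
    intro hM
    rw [hM, ENNReal.top_mul] at h
    · exact (ENNReal.mul_lt_top ENNReal.coe_lt_top (measure_lt_top _ _)).ne (top_le_iff.1 h)
    · simp [hX0, hp0.le]
  have hfin : ∫⁻ z, ENNReal.ofReal (‖z‖ ^ (-(m * p)) * (1 - ‖z‖ ^ 2) ^ (0 : ℝ)) ∂diskMeasure a b
      < ∞ := by
    simp only [Real.rpow_zero, mul_one]
    rw [← lintegral_add_compl _ (measurableSet_ball (x := (0 : ℂ)) (ε := ε))]
    refine ENNReal.add_lt_top.2 ⟨hM.lt_top, ?_⟩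
    calc _ ≤ ∫⁻ z in (Metric.ball 0 ε)ᶜ, ENNReal.ofReal (ε ^ (-(m * p))) ∂diskMeasure a b := by
          refine setLIntegral_mono measurable_const fun z hz => ENNReal.ofReal_le_ofReal ?_
          have : ε ≤ ‖z‖ := by simpa using hz
          exact Real.rpow_le_rpow_of_nonpos hε0 this (by
            have : 0 ≤ (m : ℝ) * p := by positivity
            linarith)
      _ < ∞ := by
          rw [setLIntegral_const]
          exact ENNReal.mul_lt_top ENNReal.ofReal_lt_top (measure_lt_top _ _)
  have := (exponents_of_lintegral_diskMeasure_lt_top ha hb hfin).1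
  linarith

/-- Converse of Hölder: for h = g^{q-1} cut off where g > n, both h g and h^p equal the truncated
g^q, as (q-1)p = q. With X its integral, M 2^{-p} X^p ≤ C X. Since X is finite, this bounds X
independently of n, and Fatou removes the truncation. -/
theorem lintegral_radialKernel_rpow_lt_top {α a b : ℝ} (ha : -1 < a)
    (hb : -1 < b) {m : ℕ} {p q : ℝ} (hpq : p.HolderConjugate q)
    (hT : IsBoundedOnLp (diskMeasure a b) (ENNReal.ofReal p) (kernelT α a b m)) :
    ∫⁻ w, ENNReal.ofReal (radialKernel α a b m w ^ q) ∂diskMeasure a b < ∞ := by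
  have := isFiniteMeasure_diskMeasure ha hb
  have hp0 := hpq.pos
  have hq0 := hpq.symm.pos
  have hp1 : 0 < p - 1 := by linarith [hpq.lt]
  obtain ⟨ε, hε0, hε1, C, hC⟩ := exists_test_bound_of_isBoundedOnLp ha hb hpq.lt.le hT
  set M := ∫⁻ z in Metric.ball 0 ε, ENNReal.ofReal (‖z‖ ^ (-(m * p))) ∂diskMeasure a b with hMdef
  set g := radialKernel α a b m with hg
  have hgm : Measurable g := measurable_radialKernel α a b m
  have hgpos : ∀ᵐ w ∂diskMeasure a b, 0 < g w := by
    filter_upwards [ae_diskMeasure a b] with w hw using radialKernel_pos hw.1 hw.2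
  have hM0 : M ≠ 0 := by
    intro h0
    have : diskMeasure a b (Metric.ball 0 ε) ≤ M := by
      rw [← setLIntegral_one]
      refine setLIntegral_mono_ae' measurableSet_ball ?_
      filter_upwards [ae_diskMeasure a b] with z hz _
      rw [← ENNReal.ofReal_one]
      apply ENNReal.ofReal_le_ofReal
      refine Real.one_le_rpow_of_pos_of_le_one_of_nonpos (norm_pos_iff.2 hz.2) hz.1.le ?_
      have : 0 ≤ (m : ℝ) * p := by positivity
      linarith
    rw [h0] at this
    exact diskMeasure_ball_ne_zero ha hb (by simp) hε0 (le_zero_iff.1 this)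
  -- Only M ≠ 0 is required; M = ∞ would give B = 0, which does no harm.
  set B : ℝ≥0∞ := (C * 2 ^ p / M) ^ (1 / (p - 1)) with hB
  have hBtop : B < ∞ := by
    refine (ENNReal.rpow_lt_top_of_nonneg (by positivity) ?_)
    exact (ENNReal.div_lt_top (ENNReal.mul_ne_top ENNReal.coe_ne_top
      (ENNReal.rpow_ne_top_of_nonneg hp0.le (by simp))) hM0).ne
  set G : ℕ → ℂ → ℝ := fun n => {w | g w ≤ n}.indicator fun w => g w ^ q with hG
  have hS : ∀ n : ℕ, MeasurableSet {w | g w ≤ n} := fun n => measurableSet_le hgm measurable_const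
  have hX : ∀ n, ∫⁻ w, ENNReal.ofReal (G n w) ∂diskMeasure a b ≤ B := by
    intro n
    set X := ∫⁻ w, ENNReal.ofReal (G n w) ∂diskMeasure a b with hXdef
    have hXtop : X ≠ ∞ := by
      have : X ≤ ∫⁻ w, ENNReal.ofReal ((n : ℝ) ^ q) ∂diskMeasure a b := by
        refine lintegral_mono_ae ?_
        filter_upwards [hgpos] with w hw
        apply ENNReal.ofReal_le_ofReal
        simp only [hG, Set.indicator]
        split_ifs with h
        · exact Real.rpow_le_rpow hw.le h hq0.le
        · positivity
      refine (this.trans_lt ?_).ne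
      rw [lintegral_const]
      exact ENNReal.mul_lt_top ENNReal.ofReal_lt_top (measure_lt_top _ _)
    have h := hC ({w | g w ≤ n}.indicator fun w => g w ^ (q - 1)) ((n : ℝ) ^ (q - 1))
      ((hgm.pow_const _).indicator (hS n)) ?_ ?_
    rotate_left
    · filter_upwards [hgpos] with w hw
      exact Set.indicator_apply_nonneg fun _ => Real.rpow_nonneg hw.le _
    · filter_upwards [hgpos] with w hw
      simp only [Set.indicator]
      split_ifs with h
      · exact Real.rpow_le_rpow hw.le h (by linarith [hpq.symm.lt])
      · positivity
    have e1 : ∫⁻ w, ENNReal.ofReal (({w | g w ≤ n}.indicator (fun w => g w ^ (q - 1)) w) * g w)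
        ∂diskMeasure a b = X := by
      refine lintegral_congr_ae ?_
      filter_upwards [hgpos] with w hw
      simp only [hG, Set.indicator]
      split_ifs with h
      · rw [← Real.rpow_add_one hw.ne']; ring_nf
      · simp
    have e2 : ∫⁻ w, ENNReal.ofReal (({w | g w ≤ n}.indicator (fun w => g w ^ (q - 1)) w) ^ p)
        ∂diskMeasure a b = X := by
      refine lintegral_congr_ae ?_
      filter_upwards [hgpos] with w hw
      simp only [hG, Set.indicator]
      split_ifs with h
      · rw [← Real.rpow_mul hw.le]
        congr 2
        have := hpq.symm.sub_one_mul_conj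
        linarith
      · rw [Real.zero_rpow hp0.ne']
    rw [e1, e2] at h
    rcases eq_or_ne X 0 with hX0 | hX0
    · rw [hX0]; exact zero_le
    have h5 : X ^ (p - 1) ≤ C * 2 ^ p / M := by
      rw [ENNReal.le_div_iff_mul_le (Or.inl hM0) (Or.inr (ENNReal.mul_ne_top ENNReal.coe_ne_top
        (ENNReal.rpow_ne_top_of_nonneg hp0.le (by simp))))]
      rw [ENNReal.mul_rpow_of_nonneg _ _ hp0.le] at h
      have e3 : X ^ p = X ^ (p - 1) * X := by
        conv_rhs => rw [← ENNReal.rpow_one X, ← ENNReal.rpow_mul, one_mul]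
        rw [← ENNReal.rpow_add _ _ hX0 hXtop, sub_add_cancel]
      have e4 : (2 : ℝ≥0∞) ^ p * 2⁻¹ ^ p = 1 := by
        rw [← ENNReal.mul_rpow_of_nonneg _ _ hp0.le, ENNReal.mul_inv_cancel (by simp) (by simp),
          ENNReal.one_rpow]
      have h6 : X ^ (p - 1) * M * X ≤ C * 2 ^ p * X := by
        calc X ^ (p - 1) * M * X = (2 ^ p * 2⁻¹ ^ p) * (M * (X ^ (p - 1) * X)) := by
              rw [e4]; ring
          _ = 2 ^ p * (M * (2⁻¹ ^ p * X ^ p)) := by rw [e3]; ring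
          _ ≤ 2 ^ p * (C * X) := by gcongr
          _ = _ := by ring
      exact (ENNReal.mul_le_mul_iff_left hX0 hXtop).1 h6
    calc X = (X ^ (p - 1)) ^ (1 / (p - 1)) := by
          rw [← ENNReal.rpow_mul, mul_one_div_cancel hp1.ne', ENNReal.rpow_one]
      _ ≤ B := ENNReal.rpow_le_rpow h5 (by positivity)
  refine lt_of_le_of_lt ?_ hBtop
  calc _ = ∫⁻ w, Filter.liminf (fun n => ENNReal.ofReal (G n w)) Filter.atTop ∂diskMeasure a b := by
        refine lintegral_congr fun w => ?_
        refine (Filter.Tendsto.liminf_eq (tendsto_const_nhds.congr' ?_)).symm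
        obtain ⟨k, hk⟩ := exists_nat_ge (g w)
        filter_upwards [Filter.eventually_ge_atTop k] with n hn
        have : g w ≤ n := hk.trans (by exact_mod_cast hn)
        simp [hG, this]
    _ ≤ Filter.liminf (fun n => ∫⁻ w, ENNReal.ofReal (G n w) ∂diskMeasure a b) Filter.atTop :=
        lintegral_liminf_le fun n => ((hgm.pow_const _).indicator (hS n)).ennreal_ofReal
    _ ≤ B := by
        refine Filter.liminf_le_of_le (by isBoundedDefault) fun c hc => ?_
        obtain ⟨n, hn⟩ := hc.exists
        exact hn.trans (hX n)

theorem conditions_of_isBoundedOnLp_kernelT_of_one_lt {α a b : ℝ} (ha : -1 < a)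
    (hb : -1 < b) {m : ℕ} {p : ℝ} (hp : 1 < p)
    (hT : IsBoundedOnLp (diskMeasure a b) (ENNReal.ofReal p) (kernelT α a b m)) :
    a + 1 < p * (α + 1) ∧ 2 * b < m * p - 2 + 2 * p := by
  have hpq := Real.HolderConjugate.conjExponent hp
  set q := p.conjExponent with hq
  have hp1 : 0 < p - 1 := by linarith
  have hqp : q * (p - 1) = p := by
    rw [hq, Real.conjExponent, div_mul_cancel₀ _ hp1.ne']
  have h := lintegral_radialKernel_rpow_lt_top ha hb hpq hT
  have h2 : ∫⁻ w, ENNReal.ofReal (‖w‖ ^ (((m : ℝ) - 2 * b) * q) * (1 - ‖w‖ ^ 2) ^ ((α - a) * q))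
      ∂diskMeasure a b < ∞ := by
    refine lt_of_eq_of_lt (lintegral_congr_ae ?_) h
    filter_upwards [ae_diskMeasure a b] with w hw
    have hw1 : 0 < 1 - ‖w‖ ^ 2 := by nlinarith [hw.1, norm_nonneg w]
    rw [radialKernel, Real.mul_rpow (by positivity) (by positivity), ← Real.rpow_mul hw1.le,
      ← Real.rpow_mul (norm_nonneg _), mul_comm]
  obtain ⟨h3, h4⟩ := exponents_of_lintegral_diskMeasure_lt_top ha hb h2
  -- Multiplying by p - 1 and using q(p-1) = p eliminates q.
  have h5 : 0 < (2 * b + (m - 2 * b) * q + 2) * (p - 1) := mul_pos (by linarith) hp1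
  have h6 : 0 < (a + (α - a) * q + 1) * (p - 1) := mul_pos (by linarith) hp1
  have e5 : (2 * b + (m - 2 * b) * q + 2) * (p - 1) =
      (2 * b + 2) * (p - 1) + (m - 2 * b) * (q * (p - 1)) := by ring
  have e6 : (a + (α - a) * q + 1) * (p - 1) = (a + 1) * (p - 1) + (α - a) * (q * (p - 1)) := by ring
  rw [e5, hqp] at h5
  rw [e6, hqp] at h6
  constructor <;> nlinarith

/-! ### Necessity for p = 1. -/

theorem one_sub_mul_conj_re_pos {z w : ℂ} (hz : ‖z‖ < 1) (hw : ‖w‖ < 1) :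
    0 < (1 - z * starRingEnd ℂ w).re := by
  have h : ‖z * starRingEnd ℂ w‖ < 1 := by
    rw [norm_mul, Complex.norm_conj]
    nlinarith [norm_nonneg z, norm_nonneg w]
  have := (Complex.re_le_norm (z * starRingEnd ℂ w)).trans_lt h
  rw [Complex.sub_re, Complex.one_re]
  linarith

theorem continuousAt_kernelT {α a b : ℝ} {m : ℕ} {z w : ℂ} (hz : ‖z‖ < 1) (hw : ‖w‖ < 1)
    (hw0 : w ≠ 0) : ContinuousAt (kernelT α a b m z) w := by
  have h1 : (1 : ℝ) - ‖w‖ ^ 2 ≠ 0 := by nlinarith [norm_nonneg w]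
  have h2 : ‖w‖ ≠ 0 := norm_ne_zero_iff.2 hw0
  have h3 := one_sub_mul_conj_re_pos hz hw
  have h4 : (1 - z * starRingEnd ℂ w) ≠ 0 := fun h => by simp [h] at h3
  unfold kernelT
  refine continuousAt_const.mul (ContinuousAt.div ?_ ?_ ?_)
  · refine ContinuousAt.mul (Complex.continuous_ofReal.continuousAt.comp ?_) (by fun_prop)
    exact ContinuousAt.rpow_const (by fun_prop) (Or.inl h1)
  · refine ContinuousAt.mul (Complex.continuous_ofReal.continuousAt.comp ?_) ?_
    · exact ContinuousAt.rpow_const (by fun_prop) (Or.inl h2)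
    · refine ContinuousAt.cpow ?_ continuousAt_const (Or.inl h3)
      exact continuousAt_const.sub (continuousAt_const.mul Complex.continuous_conj.continuousAt)
  · refine mul_ne_zero ?_ ?_
    · exact Complex.ofReal_ne_zero.2 (Real.rpow_pos_of_pos (norm_pos_iff.2 hw0) _).ne'
    · simp [Complex.cpow_eq_zero_iff, h4]

/-- Averages over shrinking balls converge at points of continuity. -/
theorem tendsto_average_ball {μ : Measure ℂ} [IsFiniteMeasure μ] {F : ℂ → ℂ} {w : ℂ} {r : ℕ → ℝ}
    (hr : Filter.Tendsto r Filter.atTop (nhds 0)) (hF : ContinuousAt F w)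
    (h0 : ∀ n, μ (Metric.ball w (r n)) ≠ 0) (hi : ∀ n, IntegrableOn F (Metric.ball w (r n)) μ) :
    Filter.Tendsto (fun n => ⨍ x in Metric.ball w (r n), F x ∂μ) Filter.atTop (nhds (F w)) := by
  rw [Metric.tendsto_nhds]
  intro δ hδ
  obtain ⟨ρ, hρ, h⟩ := Metric.continuousAt_iff.1 hF (δ / 2) (by positivity)
  filter_upwards [hr.eventually (gt_mem_nhds hρ)] with n hn
  have : ⨍ x in Metric.ball w (r n), F x ∂μ ∈ Metric.closedBall (F w) (δ / 2) := by
    refine (convex_closedBall _ _).set_average_mem Metric.isClosed_closedBall (h0 n)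
      (measure_ne_top _ _) ?_ (hi n)
    filter_upwards [ae_restrict_mem measurableSet_ball] with x hx
    exact (h (lt_trans hx hn)).le
  exact lt_of_le_of_lt this (by linarith)

/-- `T` applied to the normalized indicator of a small ball around w is the average of the kernel
over that ball, and it has L¹ norm at most C. Averages converge by continuity in w, and Fatou passes
to the limit. -/
theorem lintegral_absKernel_le_of_isBoundedOnLp_one {α a b : ℝ} (ha : -1 < a) (hb : -1 < b) {m : ℕ}
    (hT : IsBoundedOnLp (diskMeasure a b) (ENNReal.ofReal 1) (kernelT α a b m)) :
    ∃ C : ℝ≥0, ∀ w : ℂ, ‖w‖ < 1 → w ≠ 0 →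
      ∫⁻ z, ENNReal.ofReal (absKernel α a b m z w) ∂diskMeasure a b ≤ C := by
  have := isFiniteMeasure_diskMeasure ha hb
  set μ := diskMeasure a b with hμ
  obtain ⟨C, hC⟩ := hT
  rw [ENNReal.ofReal_one] at hC
  refine ⟨C, fun w hw hw0 => ?_⟩
  set r : ℕ → ℝ := fun n => 1 / ((n : ℝ) + 1) with hr
  have hr0 : ∀ n, 0 < r n := fun n => by positivity
  set s : ℕ → Set ℂ := fun n => Metric.ball w (r n) with hs
  have hsm : ∀ n, MeasurableSet (s n) := fun n => measurableSet_ball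
  have hμs : ∀ n, μ (s n) ≠ 0 := fun n => diskMeasure_ball_ne_zero ha hb hw (hr0 n)
  set f : ℕ → ℂ → ℂ := fun n => (s n).indicator fun _ => 1 with hf
  have hfL : ∀ n, MemLp (f n) 1 μ := fun n =>
    memLp_indicator_const 1 (hsm n) 1 (Or.inr (measure_ne_top _ _))
  have hfK : ∀ n z, (fun w => f n w * kernelT α a b m z w) =
      (s n).indicator (kernelT α a b m z) := by
    intro n z
    ext w
    by_cases h : w ∈ s n <;> simp [hf, h]
  have hint : ∀ᵐ z ∂μ, ∀ n, IntegrableOn (kernelT α a b m z) (s n) μ := by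
    rw [ae_all_iff]
    intro n
    filter_upwards [(hC (f n) (hfL n)).1] with z hz
    rw [hfK] at hz
    exact (integrable_indicator_iff (hsm n)).1 hz
  have hle : ∀ n, ∫⁻ z, (μ (s n))⁻¹ * ‖integralOp μ (kernelT α a b m) (f n) z‖ₑ ∂μ ≤ C := by
    intro n
    have h := (hC (f n) (hfL n)).2.2
    rw [eLpNorm_one_eq_lintegral_enorm, eLpNorm_indicator_const (hsm n) one_ne_zero (by simp)] at h
    simp only [enorm_one, ENNReal.toReal_one, div_one, ENNReal.rpow_one, one_mul] at h
    rw [lintegral_const_mul' _ _ (ENNReal.inv_ne_top.2 (hμs n))]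
    calc _ ≤ (μ (s n))⁻¹ * (C * μ (s n)) := by gcongr
      _ = C * ((μ (s n))⁻¹ * μ (s n)) := by ring
      _ = C := by rw [ENNReal.inv_mul_cancel (hμs n) (measure_ne_top _ _), mul_one]
  have havg : ∀ n z, (μ (s n))⁻¹ * ‖integralOp μ (kernelT α a b m) (f n) z‖ₑ =
      ‖⨍ x in s n, kernelT α a b m z x ∂μ‖ₑ := by
    intro n z
    have hreal : 0 < μ.real (s n) := ENNReal.toReal_pos (hμs n) (measure_ne_top _ _)
    rw [setAverage_eq, enorm_smul, integralOp, hfK, integral_indicator (hsm n),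
      Real.enorm_of_nonneg (by positivity), ENNReal.ofReal_inv_of_pos hreal, Measure.real,
      ENNReal.ofReal_toReal (measure_ne_top _ _)]
  have hlim : ∀ᵐ z ∂μ, ENNReal.ofReal (absKernel α a b m z w) = Filter.liminf
      (fun n => (μ (s n))⁻¹ * ‖integralOp μ (kernelT α a b m) (f n) z‖ₑ) Filter.atTop := by
    filter_upwards [hint, ae_diskMeasure a b] with z hz hzD
    have h := (tendsto_average_ball (tendsto_one_div_add_atTop_nhds_zero_nat)
      (continuousAt_kernelT hzD.1 hw hw0) hμs hz).enorm
    simp only [havg]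
    rw [h.liminf_eq, ← ofReal_norm, norm_kernelT hw hw0]
  calc _ = ∫⁻ z, Filter.liminf
          (fun n => (μ (s n))⁻¹ * ‖integralOp μ (kernelT α a b m) (f n) z‖ₑ) Filter.atTop ∂μ :=
        lintegral_congr_ae hlim
    _ ≤ Filter.liminf (fun n => ∫⁻ z, (μ (s n))⁻¹ *
          ‖integralOp μ (kernelT α a b m) (f n) z‖ₑ ∂μ) Filter.atTop :=
        lintegral_liminf_le' fun n => (hC (f n) (hfL n)).2.1.1.enorm.const_mul _
    _ ≤ C := by
        refine Filter.liminf_le_of_le (by isBoundedDefault) fun c hc => ?_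
        obtain ⟨n, hn⟩ := hc.exists
        exact hn.trans (hle n)

theorem le_absKernel {α a b : ℝ} {m : ℕ} {z w : ℂ} (hz : ‖z‖ < 1) (hz0 : z ≠ 0) (hw : ‖w‖ < 1) :
    (1 - ‖w‖ ^ 2) ^ (α - a) * ‖w‖ ^ ((m : ℝ) - 2 * b) * ‖1 - z * starRingEnd ℂ w‖ ^ (-(2 + α)) ≤
      absKernel α a b m z w := by
  have : 0 < 1 - ‖w‖ ^ 2 := by nlinarith [norm_nonneg w]
  refine le_mul_of_one_le_left (by positivity) ?_
  exact Real.one_le_rpow_of_pos_of_le_one_of_nonpos (norm_pos_iff.2 hz0) hz.le (by simp)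

theorem conditions_of_isBoundedOnLp_kernelT_one {α a b : ℝ} (hα : -1 < α) (ha : -1 < a)
    (hb : -1 < b) {m : ℕ}
    (hT : IsBoundedOnLp (diskMeasure a b) (ENNReal.ofReal 1) (kernelT α a b m)) :
    a < α ∧ 2 * b ≤ m := by
  have := isFiniteMeasure_diskMeasure ha hb
  obtain ⟨C, hC⟩ := lintegral_absKernel_le_of_isBoundedOnLp_one ha hb hT
  have hnorm : ∀ {r : ℝ}, 0 < r → ‖(r : ℂ)‖ = r := fun {r} hr => by
    rw [Complex.norm_real, Real.norm_of_nonneg hr.le]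
  constructor
  · by_contra! hle
    set c : ℝ := 2 ^ (α - a) * 2 ^ (-|(m : ℝ) - 2 * b|) with hc
    have hc0 : 0 < c := by positivity
    -- The denominator n + 2 keeps r_n ≥ 1/2, so that r_n^{m-2b} stays bounded below.
    set r : ℕ → ℝ := fun n => 1 - 1 / ((n : ℝ) + 1 + 1) with hr
    have hr1 : ∀ n, r n < 1 := fun n => by
      have : 0 < 1 / ((n : ℝ) + 1 + 1) := by positivity
      simp only [hr]; linarith
    have hr2 : ∀ n, 1 / 2 ≤ r n := fun n => by
      have : 1 / ((n : ℝ) + 1 + 1) ≤ 1 / 2 := by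
        apply one_div_le_one_div_of_le two_pos
        have : (0 : ℝ) ≤ n := n.cast_nonneg
        linarith
      simp only [hr]; linarith
    have hrt : Filter.Tendsto r Filter.atTop (nhds 1) := by
      have h := (Filter.tendsto_add_atTop_iff_nat 1).2
        (tendsto_one_div_add_atTop_nhds_zero_nat (𝕜 := ℝ))
      have := h.const_sub 1
      simpa [hr] using this
    have hb1 : ∀ n, ∫⁻ z, ENNReal.ofReal (‖1 - z * (r n : ℂ)‖ ^ (-(2 + a))) ∂diskMeasure a b ≤
        (ENNReal.ofReal c)⁻¹ * C := by
      intro n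
      have hrn0 : 0 < r n := by linarith [hr2 n]
      have h := hC (r n : ℂ) (by rw [hnorm hrn0]; exact hr1 n)
        (by simpa using hrn0.ne')
      rw [← ENNReal.mul_le_iff_le_inv (by simpa using hc0) ENNReal.ofReal_ne_top,
        ← lintegral_const_mul _ (by fun_prop)]
      refine le_trans (lintegral_mono_ae ?_) h
      filter_upwards [ae_diskMeasure a b] with z hz
      rw [← ENNReal.ofReal_mul hc0.le]
      apply ENNReal.ofReal_le_ofReal
      refine le_trans ?_ (le_absKernel hz.1 hz.2 (by rw [hnorm hrn0]; exact hr1 n))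
      rw [hnorm hrn0, Complex.conj_ofReal]
      have hd : 1 - r n ≤ ‖1 - z * (r n : ℂ)‖ := by
        have h1 := norm_sub_norm_le (1 : ℂ) (z * (r n : ℂ))
        rw [norm_one, norm_mul, hnorm hrn0] at h1
        nlinarith [hz.1]
      have hd0 : 0 < ‖1 - z * (r n : ℂ)‖ := by linarith [hr1 n]
      -- Since 1 - r² ≤ 2(1-r) ≤ 2|1-zr| and α - a ≤ 0, the boundary factor trades for a power of
      -- |1-zr|, which raises the kernel's exponent to the critical -(2+a).
      have h2 : (2 * ‖1 - z * (r n : ℂ)‖) ^ (α - a) ≤ (1 - r n ^ 2) ^ (α - a) :=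
        Real.rpow_le_rpow_of_nonpos (by nlinarith [hr1 n]) (by nlinarith [hr1 n]) (by linarith)
      rw [Real.mul_rpow zero_le_two hd0.le] at h2
      have h3 : 2 ^ (-|(m : ℝ) - 2 * b|) ≤ r n ^ ((m : ℝ) - 2 * b) :=
        two_rpow_neg_abs_le_rpow (hr2 n) (by linarith [hr1 n])
      calc c * ‖1 - z * (r n : ℂ)‖ ^ (-(2 + a)) = (2 ^ (α - a) * ‖1 - z * (r n : ℂ)‖ ^ (α - a)) *
            2 ^ (-|(m : ℝ) - 2 * b|) * ‖1 - z * (r n : ℂ)‖ ^ (-(2 + α)) := by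
            rw [show -(2 + a) = (α - a) + -(2 + α) by ring, Real.rpow_add hd0]; ring
        _ ≤ _ := by
            have : 0 ≤ 1 - r n ^ 2 := by nlinarith [hr1 n]
            gcongr
    have hfin : ∫⁻ z, ENNReal.ofReal (‖1 - z‖ ^ (-(2 + a))) ∂diskMeasure a b ≤
        (ENNReal.ofReal c)⁻¹ * C := by
      calc _ = ∫⁻ z, Filter.liminf (fun n => ENNReal.ofReal (‖1 - z * (r n : ℂ)‖ ^ (-(2 + a))))
            Filter.atTop ∂diskMeasure a b := by
            refine lintegral_congr_ae ?_
            filter_upwards [ae_diskMeasure a b] with z hz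
            refine (Filter.Tendsto.liminf_eq (ENNReal.tendsto_ofReal ?_)).symm
            have hz1 : ‖1 - z‖ ≠ 0 := by
              rw [norm_ne_zero_iff, sub_ne_zero]
              rintro rfl
              simp at hz
            have hrc : Filter.Tendsto (fun n => (r n : ℂ)) Filter.atTop (nhds ((1 : ℝ) : ℂ)) :=
              (Complex.continuous_ofReal.tendsto 1).comp hrt
            have h := ((hrc.const_mul z).const_sub 1).norm
            rw [Complex.ofReal_one, mul_one] at h
            exact h.rpow_const (Or.inl hz1)
        _ ≤ _ := lintegral_liminf_le fun n => by fun_prop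
        _ ≤ _ := by
            refine Filter.liminf_le_of_le (by isBoundedDefault) fun d hd => ?_
            obtain ⟨n, hn⟩ := hd.exists
            exact hn.trans (hb1 n)
    have htop : ∫⁻ z, ENNReal.ofReal (‖1 - z‖ ^ (-(2 + a))) ∂diskMeasure a b = ∞ := by
      rw [lintegral_diskMeasure ha hb (by fun_prop)]
      have h := lintegral_unitDisc_critical_eq_top (β := 2 * b) (a := a) (by linarith)
      have e : ∫⁻ z in unitDisc, ENNReal.ofReal (‖z‖ ^ (2 * b) * (1 - ‖z‖ ^ 2) ^ a) *
          ENNReal.ofReal (‖1 - z‖ ^ (-(2 + a))) = ∞ := by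
        rw [← h]
        refine setLIntegral_congr_fun measurableSet_unitDisc fun z hz => ?_
        have : 0 < 1 - ‖z‖ ^ 2 := by nlinarith [mem_unitDisc.1 hz, norm_nonneg z]
        exact (ENNReal.ofReal_mul (by positivity)).symm
      rw [e, ENNReal.mul_top (by simpa using diskConst_pos ha hb)]
    rw [htop, top_le_iff] at hfin
    exact ENNReal.mul_ne_top (ENNReal.inv_ne_top.2 (by simpa using hc0)) ENNReal.coe_ne_top hfin
  · by_contra! hlt
    set c : ℝ := 2 ^ (-|α - a|) * 2 ^ (-(2 + α)) with hc
    have hc0 : 0 < c := by positivity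
    have hμ0 : diskMeasure a b Set.univ ≠ 0 := fun h =>
      diskMeasure_ball_ne_zero ha hb (w := 0) (by simp) one_pos (measure_mono_null (Set.subset_univ _) h)
    -- At w = x → 0 the rest of the kernel is bounded below uniformly in z, while x^{m-2b} would
    -- tend to infinity.
    have hbd : ∀ x : ℝ, 0 < x → x < 1 / 2 → ENNReal.ofReal (c * x ^ ((m : ℝ) - 2 * b)) ≤
        (diskMeasure a b Set.univ)⁻¹ * C := by
      intro x hx0 hx1
      have h := hC (x : ℂ) (by rw [hnorm hx0]; linarith) (by simpa using hx0.ne')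
      rw [← ENNReal.mul_le_iff_le_inv hμ0 (measure_ne_top _ _), mul_comm, ← lintegral_const]
      refine le_trans (lintegral_mono_ae ?_) h
      filter_upwards [ae_diskMeasure a b] with z hz
      apply ENNReal.ofReal_le_ofReal
      refine le_trans ?_ (le_absKernel hz.1 hz.2 (by rw [hnorm hx0]; linarith))
      rw [hnorm hx0, Complex.conj_ofReal]
      have hzx : ‖z * (x : ℂ)‖ < 1 := by
        rw [norm_mul, hnorm hx0]; nlinarith [hz.1, norm_nonneg z]
      have hd : ‖1 - z * (x : ℂ)‖ ≤ 2 := by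
        have h1 := norm_sub_le (1 : ℂ) (z * (x : ℂ))
        rw [norm_one] at h1
        linarith
      have hd0 : 0 < ‖1 - z * (x : ℂ)‖ := by
        have h1 := norm_sub_norm_le (1 : ℂ) (z * (x : ℂ))
        rw [norm_one] at h1
        linarith
      have h2 : (2 : ℝ) ^ (-(2 + α)) ≤ ‖1 - z * (x : ℂ)‖ ^ (-(2 + α)) :=
        Real.rpow_le_rpow_of_nonpos hd0 hd (by linarith)
      have h3 : 2 ^ (-|α - a|) ≤ (1 - x ^ 2) ^ (α - a) :=
        two_rpow_neg_abs_le_rpow (by nlinarith) (by nlinarith)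
      have h4 : 0 < 1 - x ^ 2 := by nlinarith
      calc c * x ^ ((m : ℝ) - 2 * b) =
            2 ^ (-|α - a|) * x ^ ((m : ℝ) - 2 * b) * 2 ^ (-(2 + α)) := by rw [hc]; ring
        _ ≤ _ := by gcongr
    have ht := (tendsto_rpow_neg_nhdsGT_zero (y := (m : ℝ) - 2 * b) (by linarith)).const_mul_atTop hc0
    have ht2 := ENNReal.tendsto_ofReal_atTop.comp ht
    have hle : (∞ : ℝ≥0∞) ≤ (diskMeasure a b Set.univ)⁻¹ * C := by
      refine le_of_tendsto ht2 ?_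
      filter_upwards [Ioo_mem_nhdsGT (show (0 : ℝ) < 1 / 2 by norm_num)] with x hx
      exact hbd x hx.1 hx.2
    exact ENNReal.mul_ne_top (ENNReal.inv_ne_top.2 hμ0) ENNReal.coe_ne_top (top_le_iff.1 hle)

end MeroBergman

/-! ### The equivalence. -/

theorem mainTheorem1 (α a b : ℝ) (hα : -1 < α) (ha : -1 < a) (hb : -1 < b)
    (m : ℕ) (p : ℝ) (hp : 1 ≤ p) :
    List.TFAE
      [ -- `T` is bounded on `L^p(𝔻, dμ_{a,b})`
        MeroBergman.IsBoundedOnLp (MeroBergman.diskMeasure a b) (ENNReal.ofReal p)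
          (MeroBergman.kernelT α a b m),
        -- `S` is bounded on `L^p(𝔻, dμ_{a,b})`
        MeroBergman.IsBoundedOnLp (MeroBergman.diskMeasure a b) (ENNReal.ofReal p)
          (MeroBergman.kernelS α a b m),
        p * (α + 1) > a + 1 ∧
          (p = 1 → (m : ℝ) - 2 < 2 * b ∧ 2 * b ≤ m) ∧
          (1 < p → m * p - 2 < 2 * b ∧ 2 * b < m * p - 2 + 2 * p) ] := by
  tfae_have 2 → 1 := MeroBergman.isBoundedOnLp_kernelT_of_kernelS ha hb hp
  tfae_have 1 → 3 := by
    intro hT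
    have hlow := MeroBergman.lower_exponent_of_isBoundedOnLp_kernelT ha hb hp hT
    rcases hp.eq_or_lt with rfl | hp1
    · obtain ⟨h1, h2⟩ := MeroBergman.conditions_of_isBoundedOnLp_kernelT_one hα ha hb hT
      exact ⟨by linarith, fun _ => ⟨by linarith, h2⟩, fun h => absurd h (lt_irrefl _)⟩
    · obtain ⟨h1, h2⟩ := MeroBergman.conditions_of_isBoundedOnLp_kernelT_of_one_lt ha hb hp1 hT
      exact ⟨h1, fun h => absurd h hp1.ne', fun _ => ⟨hlow, h2⟩⟩
  tfae_have 3 → 2 := by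
    rintro ⟨h1, h2, h3⟩
    rcases hp.eq_or_lt with rfl | hp1
    · exact MeroBergman.isBoundedOnLp_kernelS_one ha hb (by linarith) (h2 rfl).1 (h2 rfl).2
    · exact MeroBergman.isBoundedOnLp_kernelS_of_one_lt hα ha hb hp1 h1 (h3 hp1).1 (h3 hp1).2
  tfae_finish
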